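/- **Setting.** A *$*$-algebra over $\mathbb{C}$* is an associative $\mathbb{C}$-algebra $\mathcal{A}$ (here always unital) with an antilinear involutive anti-automorphism $a \mapsto a^*$. A linear functional $\omega : \mathcal{A} \to \mathbb{C}$ is positive if $\omega(a^*a) \ge 0$ for all $a$; $\mathcal{A}^+$ is the set of $a = a^*$ with $\omega(a) \ge 0$ for all positive $\omega$. A $*$-representation $(\pi, \mathfrak{H})$ of $\mathcal{A}$ is a $*$-homomorphism into the adjointable operators of a complex pre-Hilbert space $\mathfrak{H}$. A $\mathcal{B}$-$\mathcal{A}$-bimodule $\mathcal{E}$ (with compatible $\mathbb{C}$-module structure, units acting as units), together with maps $\langle\cdot,\cdot\rangle : \mathcal{E}\times\mathcal{E} \to \mathcal{A}$ and $\Theta_{\cdot,\cdot} : \mathcal{E}\times\mathcal{E} \to \mathcal{B}$, is a *Morita equivalence bimodule* for $\mathcal{B}$ and $\mathcal{A}$ if for all $x,y,z\in\mathcal{E}$, $a \in \mathcal{A}$, $b \in \mathcal{B}$: 1. $\langle\cdot,\cdot\rangle$ is $\mathbb{C}$-linear in the second argument, $\langle x,y\rangle = \langle y,x\rangle^*$,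 $\langle x, y a\rangle = \langle x,y\rangle a$, $\langle x,x\rangle \in \mathcal{A}^+$ and $\langle b x, y\rangle = \langle x, b^* y\rangle$; 2. $\Theta$ is $\mathbb{C}$-linear in the first argument, $\Theta_{x,y} = \Theta_{y,x}^*$, $\Theta_{bx,y} = b\,\Theta_{x,y}$, $\Theta_{x,x}\in\mathcal{B}^+$ and $\Theta_{x, y a} = \Theta_{x a^*, y}$; 3. $\Theta_{x,y}\, z = x \langle y, z\rangle$; 4. both are full: $\mathcal{A}$ is the $\mathbb{C}$-span of all $\langle x,y\rangle$, and $\mathcal{B}$ is the $\mathbb{C}$-span of all $\Theta_{x,y}$; 5. both satisfy the positivity condition **P**: for every $*$-representation $(\pi,\mathfrak{H})$ of $\mathcal{A}$, $\langle x\otimes\phi, y\otimes\psi\rangle := \langle \phi, \pi(\langle x,y\rangle)\psi\rangle$ extends to a positive semi-definite Hermitian form on $\mathcal{E}\otimes_{\mathcal{A}}\mathfrak{H}$; and likewise for the complex conjugate right $\mathcal{B}$-module $\overline{\mathcal{E}}$ (with $\bar{x}\, b = \overline{b^*x}$) with the $\mathcal{B}$-valued inner product $\langle \bar x, \bar y\rangle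 = \Theta_{x,y}$ and every $*$-representation of $\mathcal{B}$. $\mathcal{A}$ and $\mathcal{B}$ are *strongly Morita equivalent as $*$-algebras over $\mathbb{C}$* if such a bimodule exists. A Hermitian projection $P_0 = P_0^2 = P_0^* \in M_n(\mathcal{A})$ is *strongly full* if $\operatorname{tr} P_0 = \tau^*\tau$ for some invertible $\tau\in\mathcal{A}$. **Lemma.** Let $M$ be a smooth manifold (finite-dimensional, Hausdorff, second countable, without boundary), and let $E \to M$ be a smooth complex vector bundle of constant finite fiber dimension $k > 0$ with a smooth Hermitian fiber metric $h$ (antilinear in the first argument). Let $C^\infty(M)$ be the $*$-algebra of smooth complex functions with complex conjugation, and $\Gamma^\infty(\operatorname{End} E)$ the $*$-algebra of smooth sections of $\operatorname{End}(E)$ with the pointwise adjoint with respect to $h$. Then: * The bimodule $\Gamma^\infty(E)$ (with the pointwise actions), with $\langle s,t\rangle = h(s,t)$ and $\Theta_{s,t} = \big(v \mapsto s\, h(t,v)\big)$, is a Morita equivalence bimodule for $\Gamma^\infty(\operatorname{End} E)$ and $C^\infty(M)$. In particular, these two algebras are strongly Morita equivalent as $*$-algebras over $\mathbb{C}$. *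 There are $n \in \mathbb{N}$, a Hermitian projection $P_0\in M_n(C^\infty(M))$ and an isomorphism $\Gamma^\infty(E)\cong P_0 C^\infty(M)^n$ of right $C^\infty(M)$-modules that takes $h$ to the canonical inner product $\langle x,y\rangle=\sum_i x_i^*y_i$. Moreover, for every $n \in \mathbb{N}$ and every Hermitian projection $P_0\in M_n(C^\infty(M))$ such that $\Gamma^\infty(E)\cong P_0C^\infty(M)^n$ as right $C^\infty(M)$-modules, $P_0$ is strongly full. -/

import Mathlib

open scoped Manifold ContDiff Bundle ComplexOrder TensorProduct InnerProductSpace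

/-! ### `*`-algebras over `ℂ`: positivity, representations, strong Morita equivalence

A `*`-algebra over `ℂ` is a ring `A` with `[Algebra ℂ A] [StarRing A] [StarModule ℂ A]`.
A right `A`-module is a module over `Aᵐᵒᵖ`. -/

namespace StarMorita

section Algebraic

universe v

/-- A linear functional `f` is positive if `f (a* a) ≥ 0` for all `a` (in the order of `ℂ`
induced by `ℝ ⊆ ℂ`, so the value is in particular real). -/
def IsPositiveFunctional {A : Type*} [Ring A] [Algebra ℂ A] [StarRing A] (f : A →ₗ[ℂ] ℂ) : Prop :=
  ∀ a : A, 0 ≤ f (star a * a)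

/-- The positive elements `A⁺`: Hermitian elements on which all positive functionals are
non-negative. -/
def IsPositiveElement {A : Type*} [Ring A] [Algebra ℂ A] [StarRing A] (a : A) : Prop :=
  IsSelfAdjoint a ∧ ∀ f : A →ₗ[ℂ] ℂ, IsPositiveFunctional f → 0 ≤ f a

/-- A `*`-representation of `A` on the pre-Hilbert space `H`: a homomorphism of associative
algebras into the adjointable operators compatible with the involutions.
It is not required to be non-degenerate. -/
structure StarRepresentation (A : Type*) [Ring A] [Algebra ℂ A] [StarRing A]
    (H : Type*) [NormedAddCommGroup H] [InnerProductSpace ℂ H] where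
  /-- the underlying algebra homomorphism -/
  toHom : A →ₙₐ[ℂ] Module.End ℂ H
  inner_toHom_left : ∀ (a : A) (φ ψ : H), ⟪toHom a φ, ψ⟫_ℂ = ⟪φ, toHom (star a) ψ⟫_ℂ

section Tensor

variable {A : Type*} [Ring A] [Algebra ℂ A] [StarRing A]
  (E : Type*) [AddCommGroup E] [Module ℂ E] [Module Aᵐᵒᵖ E]
  {H : Type*} [NormedAddCommGroup H] [InnerProductSpace ℂ H]

/-- The subspace of `E ⊗_ℂ H` spanned by all `x · a ⊗ φ - x ⊗ ρ(a) φ`. -/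
def balancedRelations (ρ : StarRepresentation A H) : Submodule ℂ (E ⊗[ℂ] H) :=
  Submodule.span ℂ {t | ∃ (x : E) (a : A) (φ : H),
    t = (MulOpposite.op a • x) ⊗ₜ[ℂ] φ - x ⊗ₜ[ℂ] (ρ.toHom a φ)}

/-- The tensor product `E ⊗_A H` of a right `A`-module with a `*`-representation of `A`. -/
abbrev BalancedTensor (ρ : StarRepresentation A H) : Type _ :=
  (E ⊗[ℂ] H) ⧸ balancedRelations E ρ

variable {E}

/-- The class of `x ⊗ φ` in `E ⊗_A H`. -/
def BalancedTensor.tmul (ρ : StarRepresentation A H) (x : E) (φ : H) : BalancedTensor E ρ :=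
  (balancedRelations E ρ).mkQ (x ⊗ₜ[ℂ] φ)

end Tensor

/-- The positivity condition **P** for an `A`-valued inner product `ip` on a right `A`-module `E`:
for every `*`-representation `ρ` of `A` on a pre-Hilbert space `H`,
`⟨x ⊗ φ, y ⊗ ψ⟩ := ⟨φ, ρ(⟨x, y⟩) ψ⟩` extends to a positive semi-definite Hermitian form
on `E ⊗_A H`. -/
def PositivityP {A : Type*} [Ring A] [Algebra ℂ A] [StarRing A]
    {E : Type*} [AddCommGroup E] [Module ℂ E] [Module Aᵐᵒᵖ E] (ip : E → E → A) : Prop :=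
  ∀ (H : Type v) [NormedAddCommGroup H] [InnerProductSpace ℂ H] (ρ : StarRepresentation A H),
    ∃ S : BalancedTensor E ρ →ₗ⋆[ℂ] BalancedTensor E ρ →ₗ[ℂ] ℂ,
      (∀ (x y : E) (φ ψ : H), S (BalancedTensor.tmul ρ x φ) (BalancedTensor.tmul ρ y ψ)
        = ⟪φ, ρ.toHom (ip x y) ψ⟫_ℂ) ∧
      (∀ s t, S s t = star (S t s)) ∧ ∀ t, 0 ≤ S t t

/-- The complex conjugate `Ē` of a left module `E` over a `*`-algebra `B`: the same additive
group, with scalar multiplication `z · x̄ = (z̄ x)‾` and right `B`-action `x̄ · b = (b* x)‾`. -/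
def ConjModule (E : Type*) : Type _ := E

namespace ConjModule

variable {E : Type*} [AddCommGroup E]

instance : AddCommGroup (ConjModule E) := inferInstanceAs (AddCommGroup E)

/-- The identity map `x ↦ x̄`. -/
def mk : E ≃+ ConjModule E := AddEquiv.refl E

instance [Module ℂ E] : Module ℂ (ConjModule E) where
  smul z x := mk (star z • mk.symm x)
  one_smul x := by change star (1 : ℂ) • (mk.symm x) = _; simp; rfl
  mul_smul z w x := by
    change star (z * w) • (mk.symm x) = star z • star w • (mk.symm x)
    rw [star_mul', mul_smul]
  smul_zero z := smul_zero (A := E) (star z)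
  smul_add z x y := smul_add (A := E) (star z) _ _
  add_smul z w x := by
    change star (z + w) • (mk.symm x) = star z • (mk.symm x) + star w • (mk.symm x)
    rw [star_add, add_smul]
  zero_smul x := by change star (0 : ℂ) • (mk.symm x) = _; simp; rfl

instance {B : Type*} [Ring B] [StarRing B] [Module B E] : Module Bᵐᵒᵖ (ConjModule E) where
  smul b x := mk (star b.unop • mk.symm x)
  one_smul x := by change star (1 : B) • (mk.symm x) = _; simp; rfl
  mul_smul b c x := by
    change star (c.unop * b.unop) • (mk.symm x) = star b.unop • star c.unop • (mk.symm x)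
    rw [star_mul, mul_smul]
  smul_zero b := smul_zero (A := E) (star b.unop)
  smul_add b x y := smul_add (A := E) (star b.unop) _ _
  add_smul b c x := by
    change star (b.unop + c.unop) • (mk.symm x)
      = star b.unop • (mk.symm x) + star c.unop • (mk.symm x)
    rw [star_add, add_smul]
  zero_smul x := by change star (0 : B) • (mk.symm x) = _; simp; rfl

end ConjModule

section Morita

variable {B A : Type*} [Ring B] [Algebra ℂ B] [StarRing B] [StarModule ℂ B]
  [Ring A] [Algebra ℂ A] [StarRing A] [StarModule ℂ A]
  {E : Type*} [AddCommGroup E] [Module ℂ E] [Module B E] [Module Aᵐᵒᵖ E]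

/-- `E` with the inner products `ip` (with values in `A`) and `Θ` (with values in `B`)
is a Morita equivalence bimodule for the unital `*`-algebras `B` and `A` over `ℂ`. -/
structure IsMoritaEquivalenceBimodule (ip : E → E → A) (Θ : E → E → B) : Prop where
  /-- `E` is a `B`-`A`-bimodule with compatible `ℂ`-module structure -/
  smul_smul_comm : ∀ (b : B) (x : E) (a : A),
    b • (MulOpposite.op a • x) = MulOpposite.op a • (b • x)
  smul_assoc_left : ∀ (z : ℂ) (b : B) (x : E), (z • b) • x = z • (b • x)
  smul_assoc_right : ∀ (z : ℂ) (a : A) (x : E),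
    MulOpposite.op (z • a) • x = z • (MulOpposite.op a • x)
  /-- `ip` is an `A`-valued, `A`-right linear Hermitian inner product ... -/
  ip_linear : ∀ x, IsLinearMap ℂ (ip x)
  ip_star : ∀ x y, ip x y = star (ip y x)
  ip_smul_right : ∀ x y (a : A), ip x (MulOpposite.op a • y) = ip x y * a
  ip_pos : ∀ x, IsPositiveElement (ip x x)
  /-- ... compatible with the left action of `B` -/
  ip_smul_left : ∀ (b : B) x y, ip (b • x) y = ip x (star b • y)
  /-- `Θ` is a `B`-valued, `B`-left linear Hermitian inner product ... -/
  theta_linear : ∀ y, IsLinearMap ℂ (fun x => Θ x y)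
  theta_star : ∀ x y, Θ x y = star (Θ y x)
  theta_smul_left : ∀ (b : B) x y, Θ (b • x) y = b * Θ x y
  theta_pos : ∀ x, IsPositiveElement (Θ x x)
  /-- ... compatible with the right action of `A` -/
  theta_smul_right : ∀ x y (a : A), Θ x (MulOpposite.op a • y) = Θ (MulOpposite.op (star a) • x) y
  /-- the two inner products are compatible -/
  theta_smul_eq : ∀ x y z, Θ x y • z = MulOpposite.op (ip y z) • x
  /-- the two inner products are full -/
  ip_full : Submodule.span ℂ {a | ∃ x y, a = ip x y} = ⊤
  theta_full : Submodule.span ℂ {b | ∃ x y, b = Θ x y} = ⊤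
  /-- both inner products satisfy **P**; for `Θ` this concerns the right `B`-module `Ē` with
  the inner product `⟨x̄, ȳ⟩ = Θ x y` -/
  ip_positivityP : PositivityP.{v} ip
  theta_positivityP : PositivityP.{v} (A := B) (E := ConjModule E)
    (fun x y => Θ (ConjModule.mk.symm x) (ConjModule.mk.symm y))

end Morita

/-- `B` and `A` are strongly Morita equivalent as `*`-algebras over `ℂ`: there is a Morita
equivalence bimodule. -/
def StronglyMoritaEquivalent.{w, v', u₁, u₂} (B : Type u₁) (A : Type u₂)
    [Ring B] [Algebra ℂ B] [StarRing B] [StarModule ℂ B]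
    [Ring A] [Algebra ℂ A] [StarRing A] [StarModule ℂ A] : Prop :=
  ∃ (E : Type w) (_ : AddCommGroup E) (_ : Module ℂ E) (_ : Module B E) (_ : Module Aᵐᵒᵖ E)
    (ip : E → E → A) (Θ : E → E → B), IsMoritaEquivalenceBimodule.{v'} ip Θ

/-- The right `A`-module `P Aⁿ ⊆ Aⁿ` for a matrix `P ∈ Mₙ(A)`. -/
def matrixRange {A : Type*} [Ring A] {n : ℕ} (P : Matrix (Fin n) (Fin n) A) :
    Submodule Aᵐᵒᵖ (Fin n → A) where
  carrier := Set.range (fun v => P.mulVec v)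
  add_mem' := by
    rintro _ _ ⟨v, rfl⟩ ⟨w, rfl⟩
    exact ⟨v + w, Matrix.mulVec_add P v w⟩
  zero_mem' := ⟨0, Matrix.mulVec_zero P⟩
  smul_mem' := by
    rintro a _ ⟨v, rfl⟩
    exact ⟨a • v, Matrix.mulVec_smul P a v⟩

/-- A matrix `P` (in practice a Hermitian projection) is strongly full if `tr P = τ* τ` for an
invertible `τ ∈ A`. -/
def IsStronglyFull {A : Type*} [Ring A] [StarRing A] {n : ℕ}
    (P : Matrix (Fin n) (Fin n) A) : Prop :=
  ∃ τ : A, IsUnit τ ∧ P.trace = star τ * τ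

end Algebraic


section Bundles

set_option linter.unusedSectionVars false

open Bundle ContinuousLinearMap

variable {EM : Type*} [NormedAddCommGroup EM] [NormedSpace ℝ EM]
  {HM : Type*} [TopologicalSpace HM] (I : ModelWithCorners ℝ EM HM)
  {M : Type*} [TopologicalSpace M] [ChartedSpace HM M]

/-! ### The `*`-algebra `C^∞(M)` of smooth complex functions -/

instance : ContMDiffRing 𝓘(ℝ, ℂ) ∞ ℂ :=
  { instNormedSpaceLieAddGroup with
    contMDiff_mul := by
      rw [contMDiff_iff]
      refine ⟨continuous_mul, fun x y => ?_⟩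
      simp only [mfld_simps, chartAt_self_eq]
      rw [contDiffOn_univ]
      exact contDiff_mul }

noncomputable instance : Star C^∞⟮I, M; 𝓘(ℝ, ℂ), ℂ⟯ where
  star f := ⟨fun x => star (f x), Complex.conjCLE.contDiff.contMDiff.comp f.contMDiff⟩

noncomputable instance : StarRing C^∞⟮I, M; 𝓘(ℝ, ℂ), ℂ⟯ where
  star_involutive f := by ext x; exact star_star (f x)
  star_mul f g := by ext x; exact star_mul (f x) (g x)
  star_add f g := by ext x; exact star_add (f x) (g x)

noncomputable instance : Algebra ℂ C^∞⟮I, M; 𝓘(ℝ, ℂ), ℂ⟯ where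
  smul z f := ⟨fun x => z * f x, contMDiff_const.mul f.contMDiff⟩
  algebraMap :=
    { toFun z := ⟨fun _ => z, contMDiff_const⟩
      map_one' := rfl
      map_mul' _ _ := rfl
      map_zero' := rfl
      map_add' _ _ := rfl }
  commutes' z f := by ext x; exact mul_comm z (f x)
  smul_def' _ _ := rfl

instance : StarModule ℂ C^∞⟮I, M; 𝓘(ℝ, ℂ), ℂ⟯ where
  star_smul z f := by ext x; exact star_mul' z (f x)

/-! ### Hermitian vector bundles -/

variable (F : Type*) [NormedAddCommGroup F] [NormedSpace ℂ F]
  (E : M → Type*) [TopologicalSpace (TotalSpace F E)] [∀ x, NormedAddCommGroup (E x)]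
  [∀ x, InnerProductSpace ℂ (E x)] [FiberBundle F E] [VectorBundle ℝ F E]

/-- The scalar products of the fibers of a complex vector bundle `E` over `M` form a smooth
Hermitian fiber metric: there is a smooth section `g` of the bundle of real bilinear
maps `E × E → ℂ` with `⟪v, w⟫ = g x v w` for all `v`, `w` in the fiber over `x`. -/
class IsSmoothHermitianBundle : Prop where
  exists_contMDiff : ∃ g : Π x : M, E x →L[ℝ] E x →L[ℝ] ℂ,
    ContMDiff I (I.prod 𝓘(ℝ, F →L[ℝ] F →L[ℝ] ℂ)) ∞
      (fun x => TotalSpace.mk' (F →L[ℝ] F →L[ℝ] ℂ) x (g x))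
    ∧ ∀ (x : M) (v w : E x), ⟪v, w⟫_ℂ = g x v w

variable {F E}

theorem contMDiffAt_inner [h : IsSmoothHermitianBundle I F E] {s t : ∀ x, E x} {x₀ : M}
    (hs : ContMDiffAt I (I.prod 𝓘(ℝ, F)) ∞ (fun x => TotalSpace.mk' F x (s x)) x₀)
    (ht : ContMDiffAt I (I.prod 𝓘(ℝ, F)) ∞ (fun x => TotalSpace.mk' F x (t x)) x₀) :
    ContMDiffAt I 𝓘(ℝ, ℂ) ∞ (fun x => ⟪s x, t x⟫_ℂ) x₀ := by
  rcases h.exists_contMDiff with ⟨g, g_smooth, hg⟩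
  simp only [hg]
  have : ContMDiffAt I (I.prod 𝓘(ℝ, ℂ)) ∞
      (fun m ↦ TotalSpace.mk' ℂ (E := Bundle.Trivial M ℂ) m (g m (s m) (t m))) x₀ := by
    apply ContMDiffAt.clm_bundle_apply₂ (F₁ := F) (F₂ := F)
    · exact g_smooth.contMDiffAt
    · exact hs
    · exact ht
  simp only [contMDiffAt_totalSpace] at this
  exact this.2

/-! ### Smooth endomorphism fields -/

theorem finiteDimensional_fiber {M : Type*} [TopologicalSpace M] (F : Type*)
    [NormedAddCommGroup F] [NormedSpace ℂ F] [FiniteDimensional ℂ F] {E : M → Type*}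
    [TopologicalSpace (TotalSpace F E)] [∀ x, NormedAddCommGroup (E x)]
    [∀ x, InnerProductSpace ℂ (E x)] [FiberBundle F E] [VectorBundle ℂ F E] (x : M) :
    FiniteDimensional ℂ (E x) :=
  ((trivializationAt F E x).continuousLinearEquivAt ℂ x
    (FiberBundle.mem_baseSet_trivializationAt' x)).symm.toLinearEquiv.finiteDimensional

variable [FiniteDimensional ℂ F] [VectorBundle ℂ F E]

variable (F) in
/-- The adjoint of an endomorphism of a fiber with respect to the Hermitian metric. -/
noncomputable def fiberAdjoint {x : M} (T : E x →L[ℂ] E x) : E x →L[ℂ] E x :=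
  haveI := finiteDimensional_fiber F (E := E) x
  haveI := FiniteDimensional.complete ℂ (E x)
  ContinuousLinearMap.adjoint T

theorem fiberAdjoint_inner_left {x : M} (T : E x →L[ℂ] E x) (v w : E x) :
    ⟪fiberAdjoint F T v, w⟫_ℂ = ⟪v, T w⟫_ℂ :=
  haveI := finiteDimensional_fiber F (E := E) x
  haveI := FiniteDimensional.complete ℂ (E x)
  ContinuousLinearMap.adjoint_inner_left T w v

theorem fiberAdjoint_inner_right {x : M} (T : E x →L[ℂ] E x) (v w : E x) :
    ⟪v, fiberAdjoint F T w⟫_ℂ = ⟪T v, w⟫_ℂ :=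
  haveI := finiteDimensional_fiber F (E := E) x
  haveI := FiniteDimensional.complete ℂ (E x)
  ContinuousLinearMap.adjoint_inner_right T v w

/-- Smoothness at `x₀` of a section of the bundle `End E = Hom_ℂ(E, E)`. -/
abbrev SmoothEndAt (A : Π x : M, E x →L[ℂ] E x) (x₀ : M) : Prop :=
  ContMDiffAt I (I.prod 𝓘(ℝ, F →L[ℂ] F)) ∞
    (fun x => TotalSpace.mk' (F →L[ℂ] F) (E := fun x => E x →L[ℂ] E x) x (A x)) x₀

/-- The section `A` of `End E` in the local trivialization at `x₀`. -/
noncomputable abbrev endCoord (A : Π x : M, E x →L[ℂ] E x) (x₀ x : M) : F →L[ℂ] F :=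
  inCoordinates F E F E x₀ x x₀ x (A x)

theorem smoothEndAt_iff (A : Π x : M, E x →L[ℂ] E x) (x₀ : M) :
    SmoothEndAt I (F := F) A x₀ ↔
      ContMDiffAt I 𝓘(ℝ, F →L[ℂ] F) ∞ (endCoord (F := F) A x₀) x₀ :=
  contMDiffAt_section (F := F →L[ℂ] F) (E := fun x => E x →L[ℂ] E x) x₀

theorem eventually_mem_baseSet (x₀ : M) :
    ∀ᶠ x in nhds x₀, x ∈ (trivializationAt F E x₀).baseSet :=
  (trivializationAt F E x₀).open_baseSet.mem_nhds (FiberBundle.mem_baseSet_trivializationAt' x₀)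

/-- The local section with constant coordinates `w` in the trivialization at `x₀`. -/
noncomputable abbrev frame (x₀ : M) (w : F) (x : M) : E x := (trivializationAt F E x₀).symm x w

theorem contMDiffAt_frame (x₀ : M) (w : F) :
    ContMDiffAt I (I.prod 𝓘(ℝ, F)) ∞
      (fun x => TotalSpace.mk' F x (frame (E := E) x₀ w x)) x₀ := by
  rw [contMDiffAt_section]
  refine (contMDiffAt_const (c := w)).congr_of_eventuallyEq ?_
  filter_upwards [eventually_mem_baseSet (F := F) (E := E) x₀] with x hx
  rw [(trivializationAt F E x₀).apply_mk_symm hx]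

theorem endCoord_apply (A : Π x : M, E x →L[ℂ] E x) {x₀ x : M}
    (hx : x ∈ (trivializationAt F E x₀).baseSet) (w : F) :
    endCoord A x₀ x w = (trivializationAt F E x₀ ⟨x, A x (frame x₀ w x)⟩).2 := by
  simp [endCoord, inCoordinates, Trivialization.coe_linearMapAt_of_mem _ hx,
    Trivialization.symmL_apply _ hx]

theorem endCoord_mul (A B : Π x : M, E x →L[ℂ] E x) {x₀ x : M}
    (hx : x ∈ (trivializationAt F E x₀).baseSet) :
    endCoord (F := F) (A * B) x₀ x = endCoord A x₀ x * endCoord B x₀ x := by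
  ext w
  rw [mul_apply_eq_comp, endCoord_apply _ hx, endCoord_apply _ hx,
    endCoord_apply _ hx]
  simp [frame, Trivialization.symm_apply_apply_mk _ hx]

theorem contMDiffAt_clm_of_apply {f : M → F →L[ℂ] F} {x₀ : M}
    (hf : ∀ w, ContMDiffAt I 𝓘(ℝ, F) ∞ (fun x => f x w) x₀) :
    ContMDiffAt I 𝓘(ℝ, F →L[ℂ] F) ∞ f x₀ := by
  let b := Module.finBasis ℂ F
  let c : ∀ i, F →L[ℂ] ℂ := fun i => LinearMap.toContinuousLinearMap (b.coord i)
  have key : f = fun x => ∑ i, ((smulRightL ℂ F F (c i)).restrictScalars ℝ) (f x (b i)) := by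
    ext x w
    simp only [sum_apply, coe_restrictScalars', smulRightL_apply_apply, smulRight_apply]
    conv_lhs => rw [← b.sum_repr w, map_sum]
    exact Finset.sum_congr rfl fun i _ => (f x).map_smul _ _
  rw [key]
  exact ContMDiffAt.sum fun i _ =>
    (ContinuousLinearMap.contMDiff _).contMDiffAt.comp x₀ (hf (b i))

theorem contMDiffAt_clm_apply {f : M → F →L[ℂ] F} {s : M → F} {x₀ : M}
    (hf : ContMDiffAt I 𝓘(ℝ, F →L[ℂ] F) ∞ f x₀) (hs : ContMDiffAt I 𝓘(ℝ, F) ∞ s x₀) :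
    ContMDiffAt I 𝓘(ℝ, F) ∞ (fun x => f x (s x)) x₀ := by
  have h1 : ContMDiffAt I 𝓘(ℝ, F →L[ℝ] F) ∞ (fun x => (f x).restrictScalars ℝ) x₀ :=
    (restrictScalarsL ℂ F F ℝ ℝ).contMDiff.contMDiffAt.comp x₀ hf
  exact h1.clm_apply hs

theorem contMDiffAt_clm_mul {f g : M → F →L[ℂ] F} {x₀ : M}
    (hf : ContMDiffAt I 𝓘(ℝ, F →L[ℂ] F) ∞ f x₀) (hg : ContMDiffAt I 𝓘(ℝ, F →L[ℂ] F) ∞ g x₀) :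
    ContMDiffAt I 𝓘(ℝ, F →L[ℂ] F) ∞ (fun x => f x * g x) x₀ := by
  refine contMDiffAt_clm_of_apply I fun w => ?_
  exact contMDiffAt_clm_apply (s := fun x => g x w) I hf
    (contMDiffAt_clm_apply I hg contMDiffAt_const)

theorem SmoothEndAt.mul {A B : Π x : M, E x →L[ℂ] E x} {x₀ : M}
    (hA : SmoothEndAt I (F := F) A x₀) (hB : SmoothEndAt I (F := F) B x₀) :
    SmoothEndAt I (F := F) (A * B) x₀ := by
  rw [smoothEndAt_iff] at *
  refine (contMDiffAt_clm_mul I hA hB).congr_of_eventuallyEq ?_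
  filter_upwards [eventually_mem_baseSet (F := F) (E := E) x₀] with x hx
  exact endCoord_mul A B hx

theorem SmoothEndAt.add {A B : Π x : M, E x →L[ℂ] E x} {x₀ : M}
    (hA : SmoothEndAt I (F := F) A x₀) (hB : SmoothEndAt I (F := F) B x₀) :
    SmoothEndAt I (F := F) (A + B) x₀ := by
  rw [smoothEndAt_iff] at *
  refine (ContMDiffAt.add hA hB).congr_of_eventuallyEq (Filter.Eventually.of_forall fun x => ?_)
  ext w
  simp [endCoord, inCoordinates]

theorem smoothEndAt_algebraMap (z : ℂ) (x₀ : M) :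
    SmoothEndAt I (F := F) (E := E) (algebraMap ℂ _ z) x₀ := by
  rw [smoothEndAt_iff]
  refine (contMDiffAt_const (c := z • (1 : F →L[ℂ] F))).congr_of_eventuallyEq ?_
  filter_upwards [eventually_mem_baseSet (F := F) (E := E) x₀] with x hx
  ext w
  simp [endCoord, inCoordinates, Algebra.algebraMap_eq_smul_one,
    Trivialization.continuousLinearMapAt_symmL _ hx]

theorem SmoothEndAt.apply {A : Π x : M, E x →L[ℂ] E x} {s : Π x, E x} {x₀ : M}
    (hA : SmoothEndAt I (F := F) A x₀)
    (hs : ContMDiffAt I (I.prod 𝓘(ℝ, F)) ∞ (fun x => TotalSpace.mk' F x (s x)) x₀) :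
    ContMDiffAt I (I.prod 𝓘(ℝ, F)) ∞ (fun x => TotalSpace.mk' F x (A x (s x))) x₀ := by
  rw [smoothEndAt_iff] at hA
  rw [contMDiffAt_section] at *
  refine (contMDiffAt_clm_apply I hA hs).congr_of_eventuallyEq ?_
  filter_upwards [eventually_mem_baseSet (F := F) (E := E) x₀] with x hx
  rw [endCoord_apply _ hx]
  simp [frame, Trivialization.symm_apply_apply_mk _ hx]

theorem smoothEndAt_of_frame {A : Π x : M, E x →L[ℂ] E x} {x₀ : M}
    (h : ∀ w : F, ContMDiffAt I (I.prod 𝓘(ℝ, F)) ∞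
      (fun x => TotalSpace.mk' F x (A x (frame x₀ w x))) x₀) :
    SmoothEndAt I (F := F) A x₀ := by
  rw [smoothEndAt_iff]
  refine contMDiffAt_clm_of_apply I fun w => ?_
  have := h w
  rw [contMDiffAt_section] at this
  refine this.congr_of_eventuallyEq ?_
  filter_upwards [eventually_mem_baseSet (F := F) (E := E) x₀] with x hx
  rw [endCoord_apply _ hx]

theorem contMDiffAt_smul_section {f : M → ℂ} {s : Π x, E x} {x₀ : M}
    (hf : ContMDiffAt I 𝓘(ℝ, ℂ) ∞ f x₀)
    (hs : ContMDiffAt I (I.prod 𝓘(ℝ, F)) ∞ (fun x => TotalSpace.mk' F x (s x)) x₀) :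
    ContMDiffAt I (I.prod 𝓘(ℝ, F)) ∞ (fun x => TotalSpace.mk' F x (f x • s x)) x₀ := by
  rw [contMDiffAt_section] at *
  have h : ContMDiffAt I 𝓘(ℝ, F) ∞
      (fun x => f x • (trivializationAt F E x₀ ⟨x, s x⟩).2) x₀ := by
    have h1 : ContMDiffAt I 𝓘(ℝ, F →L[ℝ] F) ∞ (fun x => lsmul ℝ ℂ (f x)) x₀ :=
      (lsmul ℝ ℂ (E := F)).contMDiff.contMDiffAt.comp x₀ hf
    exact h1.clm_apply hs
  refine h.congr_of_eventuallyEq ?_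
  filter_upwards [eventually_mem_baseSet (F := F) (E := E) x₀] with x hx
  exact ((trivializationAt F E x₀).linear ℂ hx).2 _ _

theorem smoothEndAt_rankOne [IsSmoothHermitianBundle I F E] {s t : Π x, E x} {x₀ : M}
    (hs : ContMDiffAt I (I.prod 𝓘(ℝ, F)) ∞ (fun x => TotalSpace.mk' F x (s x)) x₀)
    (ht : ContMDiffAt I (I.prod 𝓘(ℝ, F)) ∞ (fun x => TotalSpace.mk' F x (t x)) x₀) :
    SmoothEndAt I (F := F) (fun x => InnerProductSpace.rankOne ℂ (s x) (t x)) x₀ := by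
  refine smoothEndAt_of_frame I fun w => ?_
  simp only [InnerProductSpace.rankOne_apply]
  exact contMDiffAt_smul_section I (contMDiffAt_inner I ht (contMDiffAt_frame I x₀ w)) hs

/-- The operator `w ↦ ∑ i, ⟪A e_i, w⟫ b_i` on `F`, where `e_i` is the local frame at `x₀`
given by a basis `b` of `F`, and `w` is identified with its local section. -/
noncomputable def gramOp (A : Π x : M, E x →L[ℂ] E x) (x₀ x : M) : F →L[ℂ] F :=
  ∑ i, ((innerSL ℂ (A x (frame x₀ (Module.finBasis ℂ F i) x))).comp
    ((trivializationAt F E x₀).symmL ℂ x)).smulRight (Module.finBasis ℂ F i)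

theorem gramOp_apply (A : Π x : M, E x →L[ℂ] E x) {x₀ x : M}
    (hx : x ∈ (trivializationAt F E x₀).baseSet) (w : F) :
    gramOp A x₀ x w = ∑ i, ⟪A x (frame x₀ (Module.finBasis ℂ F i) x), frame x₀ w x⟫_ℂ •
      Module.finBasis ℂ F i := by
  simp [gramOp, sum_apply, Trivialization.symmL_apply _ hx]

theorem contMDiffAt_gramOp [IsSmoothHermitianBundle I F E] {A : Π x : M, E x →L[ℂ] E x} {x₀ : M}
    (hA : SmoothEndAt I (F := F) A x₀) :
    ContMDiffAt I 𝓘(ℝ, F →L[ℂ] F) ∞ (gramOp (F := F) A x₀) x₀ := by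
  refine contMDiffAt_clm_of_apply I fun w => ?_
  have : ContMDiffAt I 𝓘(ℝ, F) ∞ (fun x => ∑ i,
      ⟪A x (frame x₀ (Module.finBasis ℂ F i) x), frame x₀ w x⟫_ℂ • Module.finBasis ℂ F i) x₀ := by
    refine ContMDiffAt.sum fun i _ => ?_
    have h := contMDiffAt_inner I (SmoothEndAt.apply I hA
      (contMDiffAt_frame I x₀ (Module.finBasis ℂ F i))) (contMDiffAt_frame I x₀ w)
    exact ((lsmul ℝ ℂ (E := F)).flip (Module.finBasis ℂ F i)).contMDiff.contMDiffAt.comp x₀ h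
  refine this.congr_of_eventuallyEq ?_
  filter_upwards [eventually_mem_baseSet (F := F) (E := E) x₀] with x hx
  exact gramOp_apply A hx w

theorem frame_endCoord (A : Π x : M, E x →L[ℂ] E x) {x₀ x : M}
    (hx : x ∈ (trivializationAt F E x₀).baseSet) (w : F) :
    frame x₀ (endCoord A x₀ x w) x = A x (frame x₀ w x) := by
  rw [endCoord_apply _ hx]
  simp [frame, Trivialization.symm_apply_apply_mk _ hx]

theorem gramOp_one_mul (A : Π x : M, E x →L[ℂ] E x) {x₀ x : M}
    (hx : x ∈ (trivializationAt F E x₀).baseSet) :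
    gramOp (F := F) (E := E) 1 x₀ x * endCoord (F := F) (fun x => fiberAdjoint F (A x)) x₀ x =
      gramOp A x₀ x := by
  ext w
  rw [mul_apply_eq_comp, gramOp_apply _ hx, gramOp_apply _ hx]
  refine Finset.sum_congr rfl fun i _ => ?_
  rw [frame_endCoord _ hx, fiberAdjoint_inner_right]
  rfl

theorem isUnit_gramOp_one {x₀ x : M} (hx : x ∈ (trivializationAt F E x₀).baseSet) :
    IsUnit (gramOp (F := F) (E := E) 1 x₀ x) := by
  have hinj : Function.Injective (gramOp (F := F) (E := E) 1 x₀ x) := by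
    rw [injective_iff_map_eq_zero]
    intro w hw
    rw [gramOp_apply _ hx] at hw
    have h0 := (Fintype.linearIndependent_iff.1 (Module.finBasis ℂ F).linearIndependent) _ hw
    have h1 : ⟪frame (E := E) x₀ w x, frame x₀ w x⟫_ℂ = 0 := by
      have : frame (E := E) x₀ w x = ∑ i, (Module.finBasis ℂ F).repr w i •
          frame x₀ (Module.finBasis ℂ F i) x := by
        simp only [frame, ← Trivialization.symmL_apply _ hx (R := ℂ)]
        conv_lhs => rw [← (Module.finBasis ℂ F).sum_repr w, map_sum]
        exact Finset.sum_congr rfl fun i _ => map_smul _ _ _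
      nth_rewrite 1 [this]
      rw [sum_inner]
      refine Finset.sum_eq_zero fun i _ => ?_
      rw [inner_smul_left]
      have := h0 i
      simp only [Pi.one_apply, one_apply_eq_self] at this
      rw [this, mul_zero]
    rw [inner_self_eq_zero] at h1
    have h2 := (trivializationAt F E x₀).continuousLinearMapAt_symmL (R := ℂ) hx w
    rw [Trivialization.symmL_apply _ hx] at h2
    rw [← h2, show (trivializationAt F E x₀).symm x w = 0 from h1, map_zero]
  have := FiniteDimensional.complete ℂ F
  rw [ContinuousLinearMap.isUnit_iff_bijective]
  exact ⟨hinj, LinearMap.surjective_of_injective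
    (f := (gramOp (F := F) (E := E) 1 x₀ x).toLinearMap) hinj⟩

theorem SmoothEndAt.adjoint [IsSmoothHermitianBundle I F E] {A : Π x : M, E x →L[ℂ] E x} {x₀ : M}
    (hA : SmoothEndAt I (F := F) A x₀) :
    SmoothEndAt I (F := F) (fun x => fiberAdjoint F (A x)) x₀ := by
  rw [smoothEndAt_iff]
  have h1 := contMDiffAt_gramOp I hA
  have h2 : ContMDiffAt I 𝓘(ℝ, F →L[ℂ] F) ∞ (gramOp (F := F) (E := E) 1 x₀) x₀ :=
    contMDiffAt_gramOp I (by simpa using smoothEndAt_algebraMap (F := F) (E := E) I 1 x₀)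
  obtain ⟨u, hu⟩ := isUnit_gramOp_one (E := E)
    (FiberBundle.mem_baseSet_trivializationAt' (F := F) (E := E) x₀)
  have h3 : ContMDiffAt I 𝓘(ℝ, F →L[ℂ] F) ∞
      (fun x => Ring.inverse (gramOp (F := F) (E := E) 1 x₀ x)) x₀ := by
    have : ContDiffAt ℝ ∞ (Ring.inverse (M₀ := F →L[ℂ] F)) (gramOp (F := F) (E := E) 1 x₀ x₀) := by
      rw [← hu]
      have := FiniteDimensional.complete ℂ F
      exact contDiffAt_ringInverse ℝ u
    exact this.contMDiffAt.comp x₀ h2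
  refine (contMDiffAt_clm_mul I h3 h1).congr_of_eventuallyEq ?_
  filter_upwards [eventually_mem_baseSet (F := F) (E := E) x₀] with x hx
  rw [← gramOp_one_mul A hx, ← mul_assoc, Ring.inverse_mul_cancel _ (isUnit_gramOp_one hx), one_mul]

variable (F E) in
/-- The algebra `Γ^∞(End E)` of smooth sections of the bundle `End E`, with pointwise
operations. -/
noncomputable def smoothEnd : Subalgebra ℂ (Π x : M, E x →L[ℂ] E x) where
  carrier := {A | ContMDiff I (I.prod 𝓘(ℝ, F →L[ℂ] F)) ∞
    (fun x => TotalSpace.mk' (F →L[ℂ] F) (E := fun x => E x →L[ℂ] E x) x (A x))}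
  mul_mem' hA hB x₀ := SmoothEndAt.mul I (hA x₀) (hB x₀)
  add_mem' hA hB x₀ := SmoothEndAt.add I (hA x₀) (hB x₀)
  algebraMap_mem' z x₀ := smoothEndAt_algebraMap I z x₀

/-- The involution of `Γ^∞(End E)`: the fiberwise adjoint with respect to the Hermitian metric. -/
noncomputable instance [IsSmoothHermitianBundle I F E] : Star (smoothEnd I F E) where
  star A := ⟨fun x => fiberAdjoint F (A.1 x), fun x₀ => SmoothEndAt.adjoint I (A.2 x₀)⟩

noncomputable instance [IsSmoothHermitianBundle I F E] : StarRing (smoothEnd I F E) where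
  star_involutive A := by
    refine Subtype.ext (funext fun x => ?_)
    exact ext fun v => ext_inner_left ℂ fun w => by
      change ⟪w, fiberAdjoint F (fiberAdjoint F (A.1 x)) v⟫_ℂ = _
      rw [fiberAdjoint_inner_right, fiberAdjoint_inner_left]
  star_mul A B := by
    refine Subtype.ext (funext fun x => ?_)
    exact ext fun v => ext_inner_left ℂ fun w => by
      change ⟪w, fiberAdjoint F (A.1 x * B.1 x) v⟫_ℂ =
        ⟪w, fiberAdjoint F (B.1 x) (fiberAdjoint F (A.1 x) v)⟫_ℂ
      simp only [fiberAdjoint_inner_right]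
      rfl
  star_add A B := by
    refine Subtype.ext (funext fun x => ?_)
    exact ext fun v => ext_inner_left ℂ fun w => by
      change ⟪w, fiberAdjoint F (A.1 x + B.1 x) v⟫_ℂ =
        ⟪w, fiberAdjoint F (A.1 x) v + fiberAdjoint F (B.1 x) v⟫_ℂ
      simp only [fiberAdjoint_inner_right, inner_add_right]
      simp

instance [IsSmoothHermitianBundle I F E] : StarModule ℂ (smoothEnd I F E) where
  star_smul z A := by
    refine Subtype.ext (funext fun x => ?_)
    exact ext fun v => ext_inner_left ℂ fun w => by
      change ⟪w, fiberAdjoint F (z • A.1 x) v⟫_ℂ = ⟪w, star z • fiberAdjoint F (A.1 x) v⟫_ℂ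
      simp [fiberAdjoint_inner_right, mul_comm]

/-! ### The bimodule `Γ^∞(E)` of smooth sections -/

noncomputable instance : Module ℂ Cₛ^∞⟮I; F, E⟯ where
  smul z s := ⟨fun x => z • s x, fun x₀ =>
    contMDiffAt_smul_section I contMDiffAt_const (s.contMDiff x₀)⟩
  one_smul s := ContMDiffSection.ext fun x => one_smul ℂ (s x)
  mul_smul z w s := ContMDiffSection.ext fun x => mul_smul z w (s x)
  smul_zero z := ContMDiffSection.ext fun _ => smul_zero z
  smul_add z s t := ContMDiffSection.ext fun x => smul_add z (s x) (t x)
  add_smul z w s := ContMDiffSection.ext fun x => add_smul z w (s x)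
  zero_smul s := ContMDiffSection.ext fun x => zero_smul ℂ (s x)

/-- `C^∞(M)` acts on `Γ^∞(E)` from the right by pointwise multiplication. -/
noncomputable instance : Module (C^∞⟮I, M; 𝓘(ℝ, ℂ), ℂ⟯)ᵐᵒᵖ Cₛ^∞⟮I; F, E⟯ where
  smul f s := ⟨fun x => f.unop x • s x, fun x₀ =>
    contMDiffAt_smul_section I (f.unop.contMDiff x₀) (s.contMDiff x₀)⟩
  one_smul s := ContMDiffSection.ext fun x => one_smul ℂ (s x)
  mul_smul f g s := ContMDiffSection.ext fun x => by
    change (g.unop x * f.unop x) • s x = f.unop x • g.unop x • s x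
    rw [mul_comm, mul_smul]
  smul_zero f := ContMDiffSection.ext fun x => smul_zero (f.unop x)
  smul_add f s t := ContMDiffSection.ext fun x => smul_add (f.unop x) (s x) (t x)
  add_smul f g s := ContMDiffSection.ext fun x => add_smul (f.unop x) (g.unop x) (s x)
  zero_smul s := ContMDiffSection.ext fun x => zero_smul ℂ (s x)

/-- `Γ^∞(End E)` acts on `Γ^∞(E)` from the left by pointwise application. -/
noncomputable instance : Module (smoothEnd I F E) Cₛ^∞⟮I; F, E⟯ where
  smul A s := ⟨fun x => A.1 x (s x), fun x₀ => SmoothEndAt.apply I (A.2 x₀) (s.contMDiff x₀)⟩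
  one_smul _ := rfl
  mul_smul _ _ _ := rfl
  smul_zero A := ContMDiffSection.ext fun x => map_zero (A.1 x)
  smul_add A s t := ContMDiffSection.ext fun x => map_add (A.1 x) (s x) (t x)
  add_smul _ _ _ := rfl
  zero_smul _ := rfl

variable [IsSmoothHermitianBundle I F E]

/-- The `C^∞(M)`-valued inner product `x ↦ h(s(x), t(x))` of smooth sections. -/
noncomputable def sectionInner (s t : Cₛ^∞⟮I; F, E⟯) : C^∞⟮I, M; 𝓘(ℝ, ℂ), ℂ⟯ :=
  ⟨fun x => ⟪s x, t x⟫_ℂ, fun x₀ => contMDiffAt_inner I (s.contMDiff x₀) (t.contMDiff x₀)⟩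

/-- The `Γ^∞(End E)`-valued inner product of smooth sections: at `x` it is the rank one operator
`v ↦ h(t(x), v) s(x)`. -/
noncomputable def sectionTheta (s t : Cₛ^∞⟮I; F, E⟯) : smoothEnd I F E :=
  ⟨fun x => InnerProductSpace.rankOne ℂ (s x) (t x),
    fun x₀ => smoothEndAt_rankOne I (s.contMDiff x₀) (t.contMDiff x₀)⟩

end Bundles

end StarMorita

universe v uM uF uE

set_option linter.unusedSectionVars false

namespace StarMorita

/-! ### Positivity and **P** from factorized inner products -/

section Factorization

variable {A : Type*} [Ring A] [Algebra ℂ A] [StarRing A]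

/-! Everything follows from a finite Parseval frame `s_i` of smooth sections, that is, `∑ h(s_i, v)
s_i = v` on every fiber.

Such a frame writes `⟨u, v⟩` as `∑ ⟨s_i, u⟩* ⟨s_i, v⟩`. This makes `⟨x, x⟩` a sum of squares and
gives **P**, because the form on `E ⊗_A H` becomes a sum of inner products pulled back along maps to
`H` (`positivityP_of_eq_sum`). It also says `∑ Θ_{s_i, s_i} = 1`, so `Θ` is full. Taking traces
gives `∑ ⟨s_i, s_i⟩ = k`, the rank, and with `t_i = s_i / √k` one gets `∑ ⟨t_i, t_i⟩ = 1`. Hence the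
scalar inner product is full, and `Θ_{x,y} = ∑ Θ_{t_i,x}* Θ_{t_i,y}` gives positivity and **P** for
`Θ`. The Gram matrix of the frame is the projection `P₀`, and every other projection presenting the
same module also has trace `k = √k* √k`, since the trace of the identity does not depend on the dual
basis (`trace_eq_sum_of_equiv_matrixRange`).

A Parseval frame is obtained in two steps. Finitely many sections spanning all fibers exist even for
noncompact `M` (`exists_spansOn_univ`): a Hausdorff dimension count bounds the number needed over
any compact set uniformly, and the families over successive shells of an exhaustion are glued in
three classes of disjointly supported sections. The spanning family is then normalized
(`exists_isParsevalFrame`). In place of the inverse square root of the frame operator, the proof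
uses a smooth Cholesky factor (`exists_cholesky`) of a positive definite matrix function, which
needs only square roots of positive functions. -/

theorem isPositiveElement_sum_star_mul {ι : Type*} [Fintype ι] (c : ι → A) :
    IsPositiveElement (∑ i, star (c i) * c i) := by
  refine ⟨isSelfAdjoint_sum _ fun i _ => IsSelfAdjoint.star_mul_self (c i), fun f hf => ?_⟩
  rw [map_sum]
  exact Finset.sum_nonneg fun i _ => hf (c i)

variable {E : Type*} [AddCommGroup E] [Module ℂ E] [Module Aᵐᵒᵖ E]
  {H : Type*} [NormedAddCommGroup H] [InnerProductSpace ℂ H]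

/-- The map `E ⊗_A H → H`, `x ⊗ φ ↦ ρ(c(x)) φ`, for a right linear map `c : E → A`. -/
noncomputable def BalancedTensor.lift (ρ : StarRepresentation A H) (c : E →ₗ[ℂ] A)
    (hc : ∀ x a, c (MulOpposite.op a • x) = c x * a) : BalancedTensor E ρ →ₗ[ℂ] H :=
  (balancedRelations E ρ).liftQ
    (TensorProduct.lift ((ρ.toHom : A →ₗ[ℂ] Module.End ℂ H).comp c)) (by
      rw [balancedRelations, Submodule.span_le]
      rintro _ ⟨x, a, φ, rfl⟩
      simp [hc, map_mul])

/-- An inner product of the form `⟨x, y⟩ = ∑ i, c_i(x)* c_i(y)` with right linear maps `c_i`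
satisfies **P**. -/
theorem positivityP_of_eq_sum {ι : Type*} [Fintype ι] {ip : E → E → A} (c : ι → E →ₗ[ℂ] A)
    (hc : ∀ i x a, c i (MulOpposite.op a • x) = c i x * a)
    (h : ∀ x y, ip x y = ∑ i, star (c i x) * c i y) : PositivityP.{v} ip := by
  intro H _ _ ρ
  let L i := BalancedTensor.lift ρ (c i) (hc i)
  -- The form is `(s, t) ↦ ∑ ⟪L_i s, L_i t⟫`, so hermiticity and positivity are inherited from `H`.
  refine ⟨∑ i, ((innerₛₗ ℂ (E := H)).comp (L i)).compl₂ (L i), fun x y φ ψ => ?_,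
    fun s t => ?_, fun t => ?_⟩
  · rw [h, map_sum]
    simp only [LinearMap.sum_apply, LinearMap.compl₂_apply, LinearMap.comp_apply, innerₛₗ_apply_apply,
      inner_sum, map_mul, Module.End.mul_apply]
    refine Finset.sum_congr rfl fun i _ => ?_
    rw [← ρ.inner_toHom_left]
    rfl
  · simp only [LinearMap.sum_apply, LinearMap.compl₂_apply, LinearMap.comp_apply, innerₛₗ_apply_apply,
      star_sum]
    exact Finset.sum_congr rfl fun i _ => (inner_conj_symm _ _).symm
  · simp only [LinearMap.sum_apply, LinearMap.compl₂_apply, LinearMap.comp_apply, innerₛₗ_apply_apply]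
    refine Finset.sum_nonneg fun i _ => ?_
    rw [inner_self_eq_norm_sq_to_K]
    positivity

end Factorization

/-! ### Parseval frames and the Morita bimodule -/

section Parseval

variable {EM : Type*} [NormedAddCommGroup EM] [NormedSpace ℝ EM]
  {HM : Type*} [TopologicalSpace HM] {I : ModelWithCorners ℝ EM HM}
  {M : Type*} [TopologicalSpace M] [ChartedSpace HM M]
  {F : Type*} [NormedAddCommGroup F] [NormedSpace ℂ F]
  {E : M → Type*} [TopologicalSpace (Bundle.TotalSpace F E)] [∀ x, NormedAddCommGroup (E x)]
  [∀ x, InnerProductSpace ℂ (E x)] [FiberBundle F E] [VectorBundle ℝ F E]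

theorem sum_section_apply {ι : Type*} (S : Finset ι) (s : ι → Cₛ^∞⟮I; F, E⟯) (x : M) :
    (∑ i ∈ S, s i) x = ∑ i ∈ S, s i x := by
  change ContMDiffSection.coeAddHom I F ∞ E (∑ i ∈ S, s i) x = _
  rw [map_sum, Finset.sum_apply]
  rfl

theorem sum_function_apply {ι : Type*} (S : Finset ι) (s : ι → C^∞⟮I, M; 𝓘(ℝ, ℂ), ℂ⟯) (x : M) :
    (∑ i ∈ S, s i) x = ∑ i ∈ S, s i x :=
  map_sum (ContMDiffMap.evalRingHom x : C^∞⟮I, M; 𝓘(ℝ, ℂ), ℂ⟯ →+* ℂ) _ _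

variable [FiniteDimensional ℂ F] [VectorBundle ℂ F E] [IsSmoothHermitianBundle I F E]

/-- Smooth sections `s_i` form a Parseval frame if `∑ i, h(s_i, v) s_i = v` for all `v`. -/
def IsParsevalFrame {ι : Type*} [Fintype ι] (s : ι → Cₛ^∞⟮I; F, E⟯) : Prop :=
  ∀ (x : M) (v : E x), ∑ i, ⟪s i x, v⟫_ℂ • s i x = v

@[simp] theorem sectionInner_apply (s t : Cₛ^∞⟮I; F, E⟯) (x : M) :
    sectionInner I s t x = ⟪s x, t x⟫_ℂ := rfl

@[simp] theorem sectionTheta_apply (s t : Cₛ^∞⟮I; F, E⟯) (x : M) :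
    (sectionTheta I s t).1 x = InnerProductSpace.rankOne ℂ (s x) (t x) := rfl

@[simp] theorem complex_smul_section_apply (z : ℂ) (s : Cₛ^∞⟮I; F, E⟯) (x : M) :
    (z • s) x = z • s x := rfl

@[simp] theorem star_smoothEnd_apply (A : smoothEnd I F E) (x : M) :
    (star A).1 x = fiberAdjoint F (A.1 x) := rfl

@[simp] theorem star_function_apply (f : C^∞⟮I, M; 𝓘(ℝ, ℂ), ℂ⟯) (x : M) :
    (star f) x = star (f x) := rfl

theorem smoothEnd_ext {A B : smoothEnd I F E} (h : ∀ x v, A.1 x v = B.1 x v) : A = B :=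
  Subtype.ext (funext fun x => ContinuousLinearMap.ext (h x))

theorem sum_smoothEnd_apply {ι : Type*} (S : Finset ι) (s : ι → smoothEnd I F E) (x : M) (v : E x) :
    (∑ i ∈ S, s i).1 x v = ∑ i ∈ S, (s i).1 x v := by
  change (smoothEnd I F E).val (∑ i ∈ S, s i) x v = _
  rw [map_sum, Finset.sum_apply, sum_apply]
  rfl

theorem sectionInner_linear (x : Cₛ^∞⟮I; F, E⟯) : IsLinearMap ℂ (sectionInner I x) where
  map_add _ _ := by ext; exact inner_add_right ..
  map_smul _ _ := by ext; exact inner_smul_right ..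

theorem sectionInner_star (x y : Cₛ^∞⟮I; F, E⟯) :
    sectionInner I x y = star (sectionInner I y x) := by
  ext; exact (inner_conj_symm _ _).symm

theorem sectionInner_op_smul_right (x y : Cₛ^∞⟮I; F, E⟯) (a : C^∞⟮I, M; 𝓘(ℝ, ℂ), ℂ⟯) :
    sectionInner I x (MulOpposite.op a • y) = sectionInner I x y * a := by
  ext p
  exact (inner_smul_right ..).trans (mul_comm _ _)

theorem sectionInner_smul_left (b : smoothEnd I F E) (x y : Cₛ^∞⟮I; F, E⟯) :
    sectionInner I (b • x) y = sectionInner I x (star b • y) := by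
  ext p; exact (fiberAdjoint_inner_right (F := F) (b.1 p) (x p) (y p)).symm

theorem sectionTheta_linear (y : Cₛ^∞⟮I; F, E⟯) : IsLinearMap ℂ fun x => sectionTheta I x y where
  map_add _ _ := smoothEnd_ext fun _ _ => smul_add ..
  map_smul _ _ := smoothEnd_ext fun _ _ => smul_comm ..

theorem sectionTheta_star (x y : Cₛ^∞⟮I; F, E⟯) :
    sectionTheta I x y = star (sectionTheta I y x) := by
  refine smoothEnd_ext fun p v => ext_inner_left ℂ fun w => ?_
  rw [star_smoothEnd_apply, fiberAdjoint_inner_right]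
  simp [inner_smul_right, mul_comm]

theorem sectionTheta_smul_left (b : smoothEnd I F E) (x y : Cₛ^∞⟮I; F, E⟯) :
    sectionTheta I (b • x) y = b * sectionTheta I x y :=
  smoothEnd_ext fun p _ => ((b.1 p).map_smul _ _).symm

/-- On the conjugate module, where `ȳ · b` is the class of `b* y`, this is right linearity of `ȳ ↦
Θ_{x,y}`. -/
theorem sectionTheta_star_smul_right (b : smoothEnd I F E) (x y : Cₛ^∞⟮I; F, E⟯) :
    sectionTheta I x (star b • y) = sectionTheta I x y * b := by
  refine smoothEnd_ext fun p v => ?_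
  change ⟪fiberAdjoint F (b.1 p) (y p), v⟫_ℂ • x p = ⟪y p, b.1 p v⟫_ℂ • x p
  rw [fiberAdjoint_inner_left]

theorem sectionTheta_op_smul_right (x y : Cₛ^∞⟮I; F, E⟯) (a : C^∞⟮I, M; 𝓘(ℝ, ℂ), ℂ⟯) :
    sectionTheta I x (MulOpposite.op a • y) = sectionTheta I (MulOpposite.op (star a) • x) y := by
  refine smoothEnd_ext fun p v => ?_
  change ⟪a p • y p, v⟫_ℂ • x p = ⟪y p, v⟫_ℂ • star (a p) • x p
  rw [inner_smul_left, smul_smul, mul_comm]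
  rfl

theorem sectionTheta_smul_eq (x y z : Cₛ^∞⟮I; F, E⟯) :
    sectionTheta I x y • z = MulOpposite.op (sectionInner I y z) • x := rfl

theorem sectionTheta_mul (x y z w : Cₛ^∞⟮I; F, E⟯) :
    sectionTheta I x y * sectionTheta I z w =
      sectionTheta I (MulOpposite.op (sectionInner I y z) • x) w := by
  rw [← sectionTheta_smul_left, sectionTheta_smul_eq]

theorem finrank_fiber (x : M) : Module.finrank ℂ (E x) = Module.finrank ℂ F :=
  ((Bundle.Trivialization.continuousLinearEquivAt ℂ (trivializationAt F E x) x
    (FiberBundle.mem_baseSet_trivializationAt' x))).toLinearEquiv.finrank_eq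

namespace IsParsevalFrame

variable {ι : Type*} [Fintype ι] {s : ι → Cₛ^∞⟮I; F, E⟯}

theorem sum_op_smul (hs : IsParsevalFrame s) (u : Cₛ^∞⟮I; F, E⟯) :
    ∑ i, MulOpposite.op (sectionInner I (s i) u) • s i = u := by
  ext x
  rw [sum_section_apply]
  exact hs x (u x)

theorem sum_sectionTheta (hs : IsParsevalFrame s) : ∑ i, sectionTheta I (s i) (s i) = 1 := by
  refine smoothEnd_ext fun x v => ?_
  rw [sum_smoothEnd_apply]
  exact hs x v

theorem sectionInner_eq_sum (hs : IsParsevalFrame s) (u v : Cₛ^∞⟮I; F, E⟯) :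
    sectionInner I u v =
    ∑ i, star (sectionInner I (s i) u) * sectionInner I (s i) v := by
  nth_rewrite 1 [← hs.sum_op_smul v]
  rw [← (sectionInner_linear u).mk'_apply, map_sum]
  refine Finset.sum_congr rfl fun i _ => ?_
  rw [IsLinearMap.mk'_apply, sectionInner_op_smul_right, ← sectionInner_star]

/-- The identity of a fiber is the sum of the rank one operators of the frame; comparing traces
gives the rank on one side and `∑ ⟨s_i, s_i⟩` on the other. -/
theorem sum_sectionInner_self (hs : IsParsevalFrame s) :
    ∑ i, sectionInner I (s i) (s i) = algebraMap ℂ _ (Module.finrank ℂ F : ℂ) := by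
  ext x
  rw [sum_function_apply]
  have := finiteDimensional_fiber F (E := E) x
  have h1 : (LinearMap.id : E x →ₗ[ℂ] E x) =
      ∑ i, (InnerProductSpace.rankOne ℂ (s i x) (s i x)).toLinearMap := by
    ext v
    simp [LinearMap.sum_apply, hs x v]
  have h2 := congrArg (LinearMap.trace ℂ (E x)) h1
  rw [LinearMap.trace_id, map_sum, finrank_fiber (F := F)] at h2
  simp only [InnerProductSpace.trace_rankOne] at h2
  exact h2.symm

/-- Dividing the frame by `√k` works since `k > 0`. This normalization serves the side of `Θ` as the
Parseval identity serves that of `h`. -/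
theorem exists_sum_sectionInner_eq_one [Nontrivial F] (hs : IsParsevalFrame s) :
    ∃ t : ι → Cₛ^∞⟮I; F, E⟯, ∑ i, sectionInner I (t i) (t i) = 1 := by
  have hk : (0 : ℝ) < Module.finrank ℂ F := by exact_mod_cast Module.finrank_pos
  let c : ℂ := ((√(Module.finrank ℂ F : ℝ))⁻¹ : ℝ)
  have hc : c * c * (Module.finrank ℂ F : ℂ) = 1 := by
    have : (√(Module.finrank ℂ F : ℝ))⁻¹ * (√(Module.finrank ℂ F : ℝ))⁻¹ *
        (Module.finrank ℂ F : ℝ) = 1 := by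
      rw [← mul_inv, Real.mul_self_sqrt hk.le, inv_mul_cancel₀ hk.ne']
    simp only [c]
    exact_mod_cast this
  refine ⟨fun i => c • s i, ?_⟩
  ext x
  have h := DFunLike.congr_fun hs.sum_sectionInner_self x
  rw [sum_function_apply] at h ⊢
  simp only [sectionInner_apply, complex_smul_section_apply, inner_smul_left, inner_smul_right,
    ← Finset.mul_sum] at h ⊢
  rw [h]
  have hcc : (starRingEnd ℂ) c = c := Complex.conj_ofReal _
  rw [hcc]
  exact (mul_assoc _ _ _).symm.trans hc

end IsParsevalFrame

/-- Each summand is `Θ_{x,t_i} Θ_{t_i,y} = Θ_{x⟨t_i,t_i⟩, y}`, and the coefficients `⟨t_i, t_i⟩` add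
up to 1. -/
theorem sectionTheta_eq_sum {ι : Type*} [Fintype ι] {t : ι → Cₛ^∞⟮I; F, E⟯}
    (ht : ∑ i, sectionInner I (t i) (t i) = 1) (x y : Cₛ^∞⟮I; F, E⟯) :
    sectionTheta I x y = ∑ i, star (sectionTheta I (t i) x) * sectionTheta I (t i) y := by
  have h : ∀ i, star (sectionTheta I (t i) x) * sectionTheta I (t i) y =
      sectionTheta I (MulOpposite.op (sectionInner I (t i) (t i)) • x) y := fun i => by
    rw [← sectionTheta_star, sectionTheta_mul]
  have h' : ∑ i, sectionTheta I (MulOpposite.op (sectionInner I (t i) (t i)) • x) y =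
      sectionTheta I (∑ i, MulOpposite.op (sectionInner I (t i) (t i)) • x) y :=
    (map_sum (sectionTheta_linear y).mk' _ _).symm
  simp_rw [h]
  rw [h', ← Finset.sum_smul, ← Finset.op_sum, ht, MulOpposite.op_one, one_smul]

theorem IsParsevalFrame.isMoritaEquivalenceBimodule [Nontrivial F] {ι : Type*} [Fintype ι]
    {s : ι → Cₛ^∞⟮I; F, E⟯} (hs : IsParsevalFrame s) :
    IsMoritaEquivalenceBimodule.{v} (B := smoothEnd I F E) (A := C^∞⟮I, M; 𝓘(ℝ, ℂ), ℂ⟯)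
      (E := Cₛ^∞⟮I; F, E⟯) (sectionInner I) (sectionTheta I) := by
  obtain ⟨t, ht⟩ := hs.exists_sum_sectionInner_eq_one
  exact
  { smul_smul_comm b x a := by ext p; exact (b.1 p).map_smul (a p) (x p)
    smul_assoc_left _ _ _ := rfl
    smul_assoc_right z a x := by ext p; exact mul_smul z (a p) (x p)
    ip_linear := sectionInner_linear
    ip_star := sectionInner_star
    ip_smul_right := sectionInner_op_smul_right
    ip_pos x := by
      rw [hs.sectionInner_eq_sum]
      exact isPositiveElement_sum_star_mul _
    ip_smul_left := sectionInner_smul_left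
    theta_linear := sectionTheta_linear
    theta_star := sectionTheta_star
    theta_smul_left := sectionTheta_smul_left
    theta_pos x := by
      rw [sectionTheta_eq_sum ht]
      exact isPositiveElement_sum_star_mul _
    theta_smul_right := sectionTheta_op_smul_right
    theta_smul_eq := sectionTheta_smul_eq
    -- `a = ∑ ⟨t_i, t_i a⟩`.
    ip_full := by
      refine eq_top_iff.2 fun a _ => ?_
      rw [← one_mul a, ← ht, Finset.sum_mul]
      exact Submodule.sum_mem _ fun i _ => Submodule.subset_span
        ⟨t i, MulOpposite.op a • t i, (sectionInner_op_smul_right ..).symm⟩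
    -- `b = ∑ Θ_{b s_i, s_i}`.
    theta_full := by
      refine eq_top_iff.2 fun b _ => ?_
      rw [← mul_one b, ← hs.sum_sectionTheta, Finset.mul_sum]
      exact Submodule.sum_mem _ fun i _ => Submodule.subset_span
        ⟨b • s i, s i, (sectionTheta_smul_left ..).symm⟩
    ip_positivityP := positivityP_of_eq_sum (fun i => (sectionInner_linear (s i)).mk')
      (fun i x a => sectionInner_op_smul_right ..) hs.sectionInner_eq_sum
    -- The factor maps are `x̄ ↦ Θ_{t_i,x}`. They are `ℂ`-linear on the conjugate module because `Θ`
    -- is antilinear in its second argument.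
    theta_positivityP := positivityP_of_eq_sum
      (fun i =>
        { toFun x := sectionTheta I (t i) (ConjModule.mk.symm x)
          map_add' x y := by
            rw [sectionTheta_star, map_add, (sectionTheta_linear (t i)).map_add]
            refine (StarRing.star_add _ _).trans ?_
            rw [← sectionTheta_star, ← sectionTheta_star]
          map_smul' z x := by
            change sectionTheta I (t i) (star z • ConjModule.mk.symm x) = _
            rw [sectionTheta_star, (sectionTheta_linear (t i)).map_smul]
            refine (StarModule.star_smul (star z) _).trans ?_
            rw [star_star, ← sectionTheta_star]
            rfl })
      (fun i x b => by
        change sectionTheta I (t i) (star b • ConjModule.mk.symm x) =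
          sectionTheta I (t i) (ConjModule.mk.symm x) * b
        exact sectionTheta_star_smul_right ..)
      fun x y => sectionTheta_eq_sum ht _ _ }

end Parseval

/-! ### The trace of a projection as an invariant of its module -/

section Projection

variable {A : Type*} [CommRing A] {Γ : Type*} [AddCommGroup Γ] [Module Aᵐᵒᵖ Γ]

/-- If `Γ ≅ P Aⁿ`, then the trace of `P` is the trace of the identity of `Γ` computed with
any dual basis. -/
theorem trace_eq_sum_of_equiv_matrixRange {n : ℕ} {P : Matrix (Fin n) (Fin n) A}
    (hP : IsIdempotentElem P) (Ψ : Γ ≃ₗ[Aᵐᵒᵖ] matrixRange P) {ι : Type*} [Fintype ι] (s : ι → Γ)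
    (c : ι → Γ →ₗ[Aᵐᵒᵖ] A) (hs : ∀ u, ∑ i, MulOpposite.op (c i u) • s i = u) :
    P.trace = ∑ i, c i (s i) := by
  let p (j : Fin n) : matrixRange P := ⟨P.mulVec (Pi.single j 1), _, rfl⟩
  -- By idempotence, the columns of `P` with the coordinate functions form a dual basis of `P Aⁿ`.
  have h1 : ∀ w : matrixRange P, ∑ j, MulOpposite.op (w.1 j) • p j = w := by
    rintro ⟨_, v, rfl⟩
    ext k
    rw [Submodule.coe_sum, Finset.sum_apply]
    simp only [p, Submodule.coe_smul, Pi.smul_apply, Matrix.mulVec_single_one, Matrix.col_apply,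
      op_smul_eq_mul]
    change ∑ j, P k j * P.mulVec v j = _
    change P.mulVec (P.mulVec v) k = _
    rw [Matrix.mulVec_mulVec, hP.eq]
  -- Each dual basis is expanded in the other. Both traces become the same double sum, by
  -- commutativity of `A`.
  have h2 : ∀ j, P j j = ∑ i, (Ψ (s i)).1 j * c i (Ψ.symm (p j)) := fun j => by
    have : P j j = (Ψ (Ψ.symm (p j))).1 j := by simp [p]
    rw [this]
    nth_rewrite 1 [← hs (Ψ.symm (p j))]
    rw [map_sum, Submodule.coe_sum, Finset.sum_apply]
    exact Finset.sum_congr rfl fun i _ => by simp [mul_comm]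
  have h3 : ∀ i, ∑ j, (Ψ (s i)).1 j * c i (Ψ.symm (p j)) = c i (s i) := fun i => by
    have : s i = ∑ j, MulOpposite.op ((Ψ (s i)).1 j) • Ψ.symm (p j) := by
      simp_rw [← map_smul]
      rw [← map_sum, h1, Ψ.symm_apply_apply]
    conv_rhs => rw [this, map_sum]
    exact Finset.sum_congr rfl fun j _ => by simp [mul_comm]
  rw [Matrix.trace]
  simp only [Matrix.diag_apply, h2]
  rw [Finset.sum_comm]
  exact Finset.sum_congr rfl fun i _ => h3 i

end Projection

/-! ### The projection attached to a Parseval frame -/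

section ParsevalProjection

variable {EM : Type*} [NormedAddCommGroup EM] [NormedSpace ℝ EM]
  {HM : Type*} [TopologicalSpace HM] {I : ModelWithCorners ℝ EM HM}
  {M : Type*} [TopologicalSpace M] [ChartedSpace HM M]
  {F : Type*} [NormedAddCommGroup F] [NormedSpace ℂ F]
  {E : M → Type*} [TopologicalSpace (Bundle.TotalSpace F E)] [∀ x, NormedAddCommGroup (E x)]
  [∀ x, InnerProductSpace ℂ (E x)] [FiberBundle F E] [VectorBundle ℝ F E]
  [FiniteDimensional ℂ F] [VectorBundle ℂ F E] [IsSmoothHermitianBundle I F E]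

namespace IsParsevalFrame

/-- The coefficient `u ↦ h(s, u)` as a module map. -/
noncomputable def coeff (s : Cₛ^∞⟮I; F, E⟯) :
    Cₛ^∞⟮I; F, E⟯ →ₗ[(C^∞⟮I, M; 𝓘(ℝ, ℂ), ℂ⟯)ᵐᵒᵖ] C^∞⟮I, M; 𝓘(ℝ, ℂ), ℂ⟯ where
  toFun := sectionInner I s
  map_add' := (sectionInner_linear s).map_add
  map_smul' a u := sectionInner_op_smul_right s u a.unop

/-- `P` is the Gram matrix of the frame and `Φ u = (⟨s_i, u⟩)_i`. The Parseval identity yields `P² =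
P`, injectivity and isometry; surjectivity holds since `P v = Φ (∑ s_j v_j)`. -/
theorem exists_equiv_matrixRange {n : ℕ} {s : Fin n → Cₛ^∞⟮I; F, E⟯} (hs : IsParsevalFrame s) :
    ∃ P : Matrix (Fin n) (Fin n) C^∞⟮I, M; 𝓘(ℝ, ℂ), ℂ⟯, IsStarProjection P ∧
      ∃ Φ : Cₛ^∞⟮I; F, E⟯ ≃ₗ[(C^∞⟮I, M; 𝓘(ℝ, ℂ), ℂ⟯)ᵐᵒᵖ] matrixRange P,
        ∀ u v, sectionInner I u v =
          ∑ i, star ((Φ u : Fin n → C^∞⟮I, M; 𝓘(ℝ, ℂ), ℂ⟯) i) *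
            (Φ v : Fin n → C^∞⟮I, M; 𝓘(ℝ, ℂ), ℂ⟯) i := by
  let P : Matrix (Fin n) (Fin n) C^∞⟮I, M; 𝓘(ℝ, ℂ), ℂ⟯ :=
    Matrix.of fun i j => sectionInner I (s i) (s j)
  have hP : ∀ v i, P.mulVec v i = sectionInner I (s i) (∑ j, MulOpposite.op (v j) • s j) :=
    fun v i => by
      refine Eq.trans ?_ (map_sum (sectionInner_linear (s i)).mk' _ _).symm
      change ∑ j, sectionInner I (s i) (s j) * v j =
        ∑ j, sectionInner I (s i) (MulOpposite.op (v j) • s j)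
      exact Finset.sum_congr rfl fun j _ => (sectionInner_op_smul_right (s i) (s j) (v j)).symm
  have hmem : ∀ u, (fun i => sectionInner I (s i) u) ∈ matrixRange P := fun u =>
    ⟨fun i => sectionInner I (s i) u, funext fun i => by
      change P.mulVec _ i = _
      rw [hP, hs.sum_op_smul]⟩
  refine ⟨P, ⟨?_, ?_⟩, LinearEquiv.ofBijective
    ((LinearMap.pi fun i => coeff (s i)).codRestrict (matrixRange P) hmem) ⟨?_, ?_⟩, ?_⟩
  · ext1 i j
    rw [Matrix.mul_apply]
    simp only [P, Matrix.of_apply]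
    rw [hs.sectionInner_eq_sum (s i) (s j)]
    simp_rw [← sectionInner_star]
  · ext1 i j
    exact (sectionInner_star _ _).symm
  · intro u v huv
    rw [← hs.sum_op_smul u, ← hs.sum_op_smul v]
    refine Finset.sum_congr rfl fun i _ => ?_
    have : sectionInner I (s i) u = sectionInner I (s i) v :=
      congrFun (congrArg Subtype.val huv) i
    rw [this]
  · rintro ⟨_, v, rfl⟩
    exact ⟨∑ j, MulOpposite.op (v j) • s j, Subtype.ext (funext fun i => (hP v i).symm)⟩
  · exact hs.sectionInner_eq_sum

/-- The frame and its coefficient maps form a dual basis of `Γ^∞(E)`, so `tr P = ∑ ⟨s_i, s_i⟩ = k`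
and the constant `τ = √k` works. -/
theorem isStronglyFull_of_equiv [Nontrivial F] {ι : Type*} [Fintype ι] {s : ι → Cₛ^∞⟮I; F, E⟯}
    (hs : IsParsevalFrame s) {n : ℕ} {P : Matrix (Fin n) (Fin n) C^∞⟮I, M; 𝓘(ℝ, ℂ), ℂ⟯}
    (hP : IsStarProjection P)
    (Ψ : Cₛ^∞⟮I; F, E⟯ ≃ₗ[(C^∞⟮I, M; 𝓘(ℝ, ℂ), ℂ⟯)ᵐᵒᵖ] matrixRange P) : IsStronglyFull P := by
  have hk : (0 : ℝ) < Module.finrank ℂ F := by exact_mod_cast Module.finrank_pos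
  let c : ℂ := (√(Module.finrank ℂ F : ℝ) : ℝ)
  have hc : star c * c = (Module.finrank ℂ F : ℂ) := by
    have h : star c = c := Complex.conj_ofReal _
    rw [h]
    simp only [c]
    exact_mod_cast Real.mul_self_sqrt hk.le
  have hc0 : c ≠ 0 := by
    simp only [c]
    exact_mod_cast (Real.sqrt_pos.2 hk).ne'
  refine ⟨algebraMap ℂ _ c, (IsUnit.mk0 c hc0).map (algebraMap ℂ _), ?_⟩
  rw [trace_eq_sum_of_equiv_matrixRange hP.isIdempotentElem Ψ s (fun i => coeff (s i))
    hs.sum_op_smul]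
  refine hs.sum_sectionInner_self.trans ?_
  rw [← hc, map_mul]
  rfl

end IsParsevalFrame

end ParsevalProjection

/-! ### Smooth Cholesky decomposition -/

section Cholesky

variable {EM : Type*} [NormedAddCommGroup EM] [NormedSpace ℝ EM]
  {HM : Type*} [TopologicalSpace HM] {I : ModelWithCorners ℝ EM HM}
  {M : Type*} [TopologicalSpace M] [ChartedSpace HM M]

/-- A pointwise positive smooth function has a pointwise positive smooth square root. -/
theorem exists_real_sqrt {a : C^∞⟮I, M; 𝓘(ℝ, ℂ), ℂ⟯} (ha : ∀ x, 0 < a x) :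
    ∃ r q : C^∞⟮I, M; 𝓘(ℝ, ℂ), ℂ⟯, star r = r ∧ star q = q ∧ r * r = a ∧ r * q = 1 := by
  have hpos : ∀ x, 0 < (a x).re := fun x => (Complex.pos_iff.1 (ha x)).1
  have hre : ContMDiff I 𝓘(ℝ, ℝ) ∞ (fun x => (a x).re) :=
    Complex.reCLM.contDiff.contMDiff.comp a.contMDiff
  have hsqrt : ContMDiff I 𝓘(ℝ, ℝ) ∞ (fun x => √(a x).re) := fun x =>
    (Real.contDiffAt_sqrt (hpos x).ne').contMDiffAt.comp x (hre x)
  have hinv : ContMDiff I 𝓘(ℝ, ℝ) ∞ (fun x => (√(a x).re)⁻¹) := fun x =>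
    (contDiffAt_inv ℝ (Real.sqrt_pos.2 (hpos x)).ne').contMDiffAt.comp x (hsqrt x)
  refine ⟨⟨fun x => ((√(a x).re : ℝ) : ℂ), Complex.ofRealCLM.contDiff.contMDiff.comp hsqrt⟩,
    ⟨fun x => (((√(a x).re)⁻¹ : ℝ) : ℂ), Complex.ofRealCLM.contDiff.contMDiff.comp hinv⟩,
    ?_, ?_, ?_, ?_⟩
  · ext x; exact Complex.conj_ofReal _
  · ext x; exact Complex.conj_ofReal _
  · ext x
    change ((√(a x).re : ℝ) : ℂ) * ((√(a x).re : ℝ) : ℂ) = a x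
    rw [← Complex.ofReal_mul, Real.mul_self_sqrt (hpos x).le]
    exact Complex.ext rfl (Complex.pos_iff.1 (ha x)).2
  · ext x
    change ((√(a x).re : ℝ) : ℂ) * (((√(a x).re)⁻¹ : ℝ) : ℂ) = 1
    rw [← Complex.ofReal_mul, mul_inv_cancel₀ (Real.sqrt_pos.2 (hpos x)).ne', Complex.ofReal_one]

/-- Smooth Cholesky decomposition of a pointwise positive definite Hermitian matrix. -/
theorem exists_cholesky {n : ℕ} (H : Fin n → Fin n → C^∞⟮I, M; 𝓘(ℝ, ℂ), ℂ⟯)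
    (hH : ∀ i j, H i j = star (H j i))
    (hpos : ∀ x, ∀ v : Fin n → ℂ, v ≠ 0 → 0 < ∑ i, ∑ j, star (v i) * H i j x * v j) :
    ∃ W : Fin n → Fin n → C^∞⟮I, M; 𝓘(ℝ, ℂ), ℂ⟯,
      ∀ i j, H i j = ∑ l, star (W l i) * W l j := by
  induction n with
  | zero => exact ⟨fun i => i.elim0, fun i => i.elim0⟩
  | succ n ih =>
    have ha : ∀ x, 0 < H 0 0 x := fun x => by
      have := hpos x (Pi.single 0 1) (by simp)
      simpa [Fin.sum_univ_succ] using this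
    obtain ⟨r, q, hr, hq, hrr, hrq⟩ := exists_real_sqrt ha
    -- The Schur complement of the corner entry: `q² = 1 / H₀₀`.
    let H' : Fin n → Fin n → C^∞⟮I, M; 𝓘(ℝ, ℂ), ℂ⟯ := fun i j =>
      H i.succ j.succ - star (q * H 0 i.succ) * (q * H 0 j.succ)
    obtain ⟨W, hW⟩ := ih H' (fun i j => by
        simp only [H', star_sub, star_mul, star_star]
        rw [← hH i.succ j.succ]) (fun x v hv => by
        let c := ∑ j, H 0 j.succ x * v j
        -- The first coordinate `-c / H₀₀` completes the square: at this vector the form of `H`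
        -- equals the form of `H'` at `v`.
        have h1 := hpos x (Fin.cons (-(q x * q x * c)) v : Fin (n + 1) → ℂ) (fun h => hv (by
          ext i
          simpa using congrFun h i.succ))
        convert h1 using 1
        have hqx : star (q x) = q x := DFunLike.congr_fun hq x
        have hrrx : r x * r x = H 0 0 x := DFunLike.congr_fun hrr x
        have hrqx : r x * q x = 1 := DFunLike.congr_fun hrq x
        have hHx : ∀ i j, H i j x = star (H j i x) := fun i j => DFunLike.congr_fun (hH i j) x
        have hc : star c = ∑ i, star (v i) * H i.succ 0 x := by
          simp only [c, star_sum, star_mul']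
          exact Finset.sum_congr rfl fun i _ => by rw [hHx i.succ 0, mul_comm]
        have e1 : ∀ i j, star (v i) * H' i j x * v j =
            star (v i) * H i.succ j.succ x * v j -
              (q x * q x) * ((star (v i) * H i.succ 0 x) * (H 0 j.succ x * v j)) := fun i j => by
          have : H' i j x = H i.succ j.succ x - star (q x * H 0 i.succ x) * (q x * H 0 j.succ x) :=
            rfl
          rw [this, star_mul', hqx, hHx i.succ 0]
          ring
        have e2 : ∑ j, star (-(q x * q x * c)) * H 0 j.succ x * v j =
            star (-(q x * q x * c)) * c := by
          simp only [c, Finset.mul_sum, mul_assoc]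
        have e3 : ∑ i, star (v i) * H i.succ 0 x * -(q x * q x * c) =
            star c * -(q x * q x * c) := by
          rw [hc, Finset.sum_mul]
        have e4 : ∑ i, star (v i) * H i.succ 0 x * ∑ j, H 0 j.succ x * v j = star c * c := by
          rw [hc, Finset.sum_mul]
        have e5 : star (-(q x * q x * c)) = -(q x * q x * star c) := by
          rw [star_neg, star_mul', star_mul', hqx]
        simp only [Fin.sum_univ_succ, Fin.cons_zero, Fin.cons_succ, e1, Finset.sum_sub_distrib,
          Finset.sum_add_distrib, ← Finset.mul_sum, e4]
        rw [e2, e3, e5, ← hrrx]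
        linear_combination (-(q x * q x * c * star c)) * (r x * q x + 1) * hrqx)
    -- Upper triangular factor: the first row is that of `H` divided by `√H₀₀`, and the lower block
    -- factors the Schur complement.
    refine ⟨Fin.cons (fun j => q * H 0 j) fun i => Fin.cons 0 (W i), fun i j => ?_⟩
    rw [Fin.sum_univ_succ]
    simp only [Fin.cons_zero, Fin.cons_succ]
    have hq2 : q * (q * H 0 0) = 1 := by
      rw [← hrr]
      linear_combination (r * q + 1) * hrq
    have hHs : ∀ j, star (H 0 j) = H j 0 := fun j => (hH j 0).symm
    refine Fin.cases ?_ (fun i => ?_) i <;> refine Fin.cases ?_ (fun j => ?_) j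
    · simp only [Fin.cons_zero, star_zero, zero_mul, Finset.sum_const_zero, add_zero, star_mul, hq,
        hHs]
      linear_combination (-H 0 0) * hq2
    · simp only [Fin.cons_zero, star_zero, zero_mul, Finset.sum_const_zero, add_zero, star_mul, hq,
        hHs]
      linear_combination (-H 0 j.succ) * hq2
    · simp only [Fin.cons_zero, mul_zero, Finset.sum_const_zero, add_zero, star_mul, hq,
        hHs]
      linear_combination (-H i.succ 0) * hq2
    · simp only [Fin.cons_succ]
      rw [← hW]
      simp only [H']
      ring

end Cholesky

/-! ### From a spanning family to a Parseval frame -/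

section Normalization

variable {EM : Type*} [NormedAddCommGroup EM] [NormedSpace ℝ EM]
  {HM : Type*} [TopologicalSpace HM] {I : ModelWithCorners ℝ EM HM}
  {M : Type*} [TopologicalSpace M] [ChartedSpace HM M]
  {F : Type*} [NormedAddCommGroup F] [NormedSpace ℂ F]
  {E : M → Type*} [TopologicalSpace (Bundle.TotalSpace F E)] [∀ x, NormedAddCommGroup (E x)]
  [∀ x, InnerProductSpace ℂ (E x)] [FiberBundle F E] [VectorBundle ℝ F E]
  [FiniteDimensional ℂ F] [VectorBundle ℂ F E]

theorem endCoord_one {x₀ x : M} (hx : x ∈ (trivializationAt F E x₀).baseSet) :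
    endCoord (F := F) (E := E) 1 x₀ x = 1 := by
  ext w
  rw [endCoord_apply _ hx]
  simp [frame, Bundle.Trivialization.apply_mk_symm _ hx]

/-- A pointwise inverse of a smooth endomorphism field is smooth. -/
theorem SmoothEndAt.of_mul_eq_one {A B : Π x : M, E x →L[ℂ] E x} {x₀ : M}
    (hA : SmoothEndAt I (F := F) A x₀) (hAB : A * B = 1) (hBA : B * A = 1) :
    SmoothEndAt I (F := F) B x₀ := by
  rw [smoothEndAt_iff] at *
  have h : ∀ x ∈ (trivializationAt F E x₀).baseSet, ∃ u : (F →L[ℂ] F)ˣ,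
      (u : F →L[ℂ] F) = endCoord A x₀ x ∧ ((u⁻¹ : (F →L[ℂ] F)ˣ) : F →L[ℂ] F) = endCoord B x₀ x :=
    fun x hx => ⟨⟨endCoord A x₀ x, endCoord B x₀ x,
      by rw [← endCoord_mul A B hx, hAB, endCoord_one hx],
      by rw [← endCoord_mul B A hx, hBA, endCoord_one hx]⟩, rfl, rfl⟩
  have h3 : ContMDiffAt I 𝓘(ℝ, F →L[ℂ] F) ∞
      (fun x => Ring.inverse (endCoord (F := F) A x₀ x)) x₀ := by
    obtain ⟨u, hu, -⟩ := h x₀ (FiberBundle.mem_baseSet_trivializationAt' x₀)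
    have : ContDiffAt ℝ ∞ (Ring.inverse (M₀ := F →L[ℂ] F)) (endCoord (F := F) A x₀ x₀) := by
      rw [← hu]
      have := FiniteDimensional.complete ℂ F
      exact contDiffAt_ringInverse ℝ u
    exact this.contMDiffAt.comp x₀ hA
  refine h3.congr_of_eventuallyEq ?_
  filter_upwards [eventually_mem_baseSet (F := F) (E := E) x₀] with x hx
  obtain ⟨u, hu, hu'⟩ := h x hx
  rw [← hu', ← hu, Ring.inverse_unit]

variable [IsSmoothHermitianBundle I F E]

/-- The frame operator `∑ i, Θ_{σ_i, σ_i}` of sections spanning every fiber is invertible. -/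
theorem exists_inverse_frameOperator {ι : Type*} [Fintype ι] {σ : ι → Cₛ^∞⟮I; F, E⟯}
    (hσ : ∀ x, Submodule.span ℂ (Set.range fun i => σ i x) = ⊤) :
    ∃ B : smoothEnd I F E, (∀ x v, ∑ i, ⟪σ i x, B.1 x v⟫_ℂ • σ i x = v) ∧
      ∀ x v, B.1 x (∑ i, ⟪σ i x, v⟫_ℂ • σ i x) = v := by
  let G : smoothEnd I F E := ∑ i, sectionTheta I (σ i) (σ i)
  have hG : ∀ x v, G.1 x v = ∑ i, ⟪σ i x, v⟫_ℂ • σ i x := fun x v => sum_smoothEnd_apply _ _ x v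
  have hinj : ∀ x, Function.Injective (G.1 x) := fun x => by
    rw [injective_iff_map_eq_zero]
    intro v hv
    -- This sum is `⟪v, G v⟫`; its vanishing makes `v` orthogonal to a spanning set.
    have h1 : ∑ i, ‖⟪σ i x, v⟫_ℂ‖ ^ 2 = 0 := by
      have h2 : ⟪v, G.1 x v⟫_ℂ = ((∑ i, ‖⟪σ i x, v⟫_ℂ‖ ^ 2 : ℝ) : ℂ) := by
        rw [hG, inner_sum, Complex.ofReal_sum]
        refine Finset.sum_congr rfl fun i _ => ?_
        rw [inner_smul_right, ← inner_conj_symm v (σ i x), Complex.mul_conj']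
        norm_cast
      rw [hv, inner_zero_right] at h2
      exact_mod_cast h2.symm
    rw [Finset.sum_eq_zero_iff_of_nonneg fun i _ => by positivity] at h1
    have h3 : ∀ w : E x, ⟪w, v⟫_ℂ = 0 := fun w => by
      have hw : w ∈ Submodule.span ℂ (Set.range fun i => σ i x) := hσ x ▸ Submodule.mem_top
      induction hw using Submodule.span_induction with
      | mem w hw =>
        obtain ⟨i, rfl⟩ := hw
        simpa using h1 i (Finset.mem_univ i)
      | zero => exact inner_zero_left v
      | add w w' _ _ h h' => rw [inner_add_left, h, h', add_zero]
      | smul c w _ h => rw [inner_smul_left, h, mul_zero]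
    exact inner_self_eq_zero.1 (h3 v)
  have hunit : ∀ x, IsUnit (G.1 x) := fun x => by
    have := finiteDimensional_fiber F (E := E) x
    have := FiniteDimensional.complete ℂ (E x)
    rw [ContinuousLinearMap.isUnit_iff_bijective]
    exact ⟨hinj x, LinearMap.surjective_of_injective (f := (G.1 x).toLinearMap) (hinj x)⟩
  have hGB : G.1 * (fun x => Ring.inverse (G.1 x)) = 1 :=
    funext fun x => Ring.mul_inverse_cancel _ (hunit x)
  have hBG : (fun x => Ring.inverse (G.1 x)) * G.1 = 1 :=
    funext fun x => Ring.inverse_mul_cancel _ (hunit x)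
  refine ⟨⟨fun x => Ring.inverse (G.1 x), fun x₀ => SmoothEndAt.of_mul_eq_one (G.2 x₀) hGB hBG⟩,
    fun x v => ?_, fun x v => ?_⟩
  · rw [← hG]
    exact DFunLike.congr_fun (congrFun hGB x) v
  · rw [← hG]
    exact DFunLike.congr_fun (congrFun hBG x) v

/-- Let `G` be the frame operator, `B = G⁻¹` and `K_{ij} = ⟨Bσ_i, Bσ_j⟩`. Any `W` with `W* W = K`
gives a Parseval frame `∑_j conj(W_{ij}) σ_j`, as `G B B G = 1`. But `K` is only semidefinite when
the family is redundant. Let `Q_{ij} = ⟨σ_i, Bσ_j⟩`, the orthogonal projection onto the coefficient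
vectors `(⟨σ_j, v⟩)_j`. Adding `1 - Q` to `K` makes it definite and changes nothing on those
vectors. -/
theorem exists_isParsevalFrame {n : ℕ} {σ : Fin n → Cₛ^∞⟮I; F, E⟯}
    (hσ : ∀ x, Submodule.span ℂ (Set.range fun i => σ i x) = ⊤) :
    ∃ s : Fin n → Cₛ^∞⟮I; F, E⟯, IsParsevalFrame s := by
  obtain ⟨B, hGB, hBG⟩ := exists_inverse_frameOperator hσ
  let τ i := B • σ i
  have hsymm : ∀ x (u v : E x), ⟪B.1 x u, v⟫_ℂ = ⟪u, B.1 x v⟫_ℂ := fun x u v => by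
    conv_lhs => rw [← hGB x v]
    conv_rhs => rw [← hGB x u]
    rw [inner_sum, sum_inner]
    refine Finset.sum_congr rfl fun i _ => ?_
    rw [inner_smul_right, inner_smul_left, inner_conj_symm, mul_comm]
  let H : Fin n → Fin n → C^∞⟮I, M; 𝓘(ℝ, ℂ), ℂ⟯ := fun i j =>
    sectionInner I (τ i) (τ j) + (if i = j then 1 else 0) - sectionInner I (σ i) (τ j)
  have hHx : ∀ i j x, H i j x = ⟪B.1 x (σ i x), B.1 x (σ j x)⟫_ℂ + (if i = j then 1 else 0) -
      ⟪σ i x, B.1 x (σ j x)⟫_ℂ := fun i j x => by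
    have : (if i = j then (1 : C^∞⟮I, M; 𝓘(ℝ, ℂ), ℂ⟯) else 0) x = if i = j then 1 else 0 := by
      split_ifs <;> rfl
    rw [← this]
    rfl
  obtain ⟨W, hW⟩ := exists_cholesky H (fun i j => by
      ext x
      rw [star_function_apply, hHx, hHx, star_sub, star_add]
      have h : ∀ u v : E x, star ⟪u, v⟫_ℂ = ⟪v, u⟫_ℂ := fun u v => inner_conj_symm v u
      rw [h, h, hsymm x (σ i x) (σ j x)]
      simp [eq_comm]) (fun x v hv => by
      let T := ∑ j, v j • σ j x
      let u := B.1 x T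
      let p j := ⟪σ j x, u⟫_ℂ
      have hT : ∑ j, p j • σ j x = T := hGB x T
      -- Here `p = Q v`, so the second term is the value of `1 - Q` at `v`. If both terms vanish,
      -- then `u = 0`, hence `p = 0` and `v = p = 0`.
      have h1 : ∑ i, ∑ j, star (v i) * H i j x * v j =
          ⟪u, u⟫_ℂ + ∑ j, star (v j - p j) * (v j - p j) := by
        have hu : u = ∑ j, v j • B.1 x (σ j x) := by simp only [u, T, map_sum, map_smul]
        have e1 : ∑ i, ∑ j, star (v i) * ⟪B.1 x (σ i x), B.1 x (σ j x)⟫_ℂ * v j = ⟪u, u⟫_ℂ := by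
          rw [hu, sum_inner]
          simp only [inner_sum, inner_smul_left, inner_smul_right]
          exact Finset.sum_congr rfl fun i _ => Finset.sum_congr rfl fun j _ => by
            rw [← starRingEnd_apply]; ring
        have e2 : ∑ i, ∑ j, star (v i) * ⟪σ i x, B.1 x (σ j x)⟫_ℂ * v j =
            ∑ i, star (v i) * p i := by
          refine Finset.sum_congr rfl fun i _ => ?_
          simp only [p, hu, inner_sum, inner_smul_right, Finset.mul_sum]
          exact Finset.sum_congr rfl fun j _ => by ring
        have e3 : ∑ j, star (p j) * v j = ⟪u, T⟫_ℂ := by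
          simp only [T, p, inner_sum, inner_smul_right]
          exact Finset.sum_congr rfl fun j _ => by rw [← inner_conj_symm u, mul_comm]; rfl
        have e4 : ∑ j, star (p j) * p j = ⟪u, T⟫_ℂ := by
          rw [← hT]
          simp only [p, inner_sum, inner_smul_right]
          exact Finset.sum_congr rfl fun j _ => by rw [← inner_conj_symm u, mul_comm]; rfl
        have e5 : ∀ j, star (v j - p j) * (v j - p j) =
            star (v j) * v j - star (v j) * p j - star (p j) * v j + star (p j) * p j := fun j => by
          rw [star_sub]; ring
        simp only [hHx, mul_sub, sub_mul, mul_add, add_mul, Finset.sum_sub_distrib,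
          Finset.sum_add_distrib, e1, e2, e5, e3, e4, mul_ite, ite_mul, mul_one, mul_zero, zero_mul,
          Finset.sum_ite_eq, Finset.mem_univ, if_true]
        ring
      have hu0 : 0 ≤ ⟪u, u⟫_ℂ := by
        rw [inner_self_eq_norm_sq_to_K]
        positivity
      have hp0 : ∀ j, 0 ≤ star (v j - p j) * (v j - p j) := fun j => star_mul_self_nonneg _
      have hsum := Finset.sum_nonneg fun j (_ : j ∈ Finset.univ) => hp0 j
      rw [h1]
      refine lt_of_le_of_ne (add_nonneg hu0 hsum) fun h0 => hv ?_
      obtain ⟨h2, h3⟩ := (add_eq_zero_iff_of_nonneg hu0 hsum).1 h0.symm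
      have hu : u = 0 := inner_self_eq_zero.1 h2
      ext j
      have h4 := (Finset.sum_eq_zero_iff_of_nonneg fun j _ => hp0 j).1 h3 j (Finset.mem_univ j)
      simpa [p, hu] using h4)
  have hWx : ∀ i j x, ∑ l, star (W l i x) * W l j x = H i j x := fun i j x => by
    rw [hW, sum_function_apply]
    rfl
  refine ⟨fun i => ∑ j, MulOpposite.op (star (W i j)) • σ j, fun x v => ?_⟩
  have h1 : ∑ k, ⟪B.1 x (σ k x), v⟫_ℂ • σ k x = v := by
    simp_rw [hsymm]
    exact hGB x v
  have h2 : ∑ j, ⟪σ j x, v⟫_ℂ • B.1 x (σ j x) = v := by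
    simp_rw [← map_smul]
    rw [← map_sum, hBG]
  -- The summand `1 - Q` of `H` annihilates the coefficient vector of `v`.
  have h3 : ∀ k, ∑ j, H k j x * ⟪σ j x, v⟫_ℂ = ⟪B.1 x (σ k x), v⟫_ℂ := fun k => by
    have h4 : ∀ w, ∑ j, ⟪w, B.1 x (σ j x)⟫_ℂ * ⟪σ j x, v⟫_ℂ = ⟪w, v⟫_ℂ := fun w => by
      conv_rhs => rw [← h2]
      simp only [inner_sum, inner_smul_right, mul_comm]
    simp only [hHx, sub_mul, add_mul, Finset.sum_sub_distrib, Finset.sum_add_distrib, h4, ite_mul,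
      one_mul, zero_mul, Finset.sum_ite_eq, Finset.mem_univ, if_true, add_sub_cancel_right]
  have h5 : ∀ l, (∑ j, MulOpposite.op (star (W l j)) • σ j) x = ∑ k, star (W l k x) • σ k x :=
    fun l => by
      rw [sum_section_apply]
      rfl
  have h6 : ∀ l, ⟪∑ k, star (W l k x) • σ k x, v⟫_ℂ = ∑ j, W l j x * ⟪σ j x, v⟫_ℂ := fun l => by
    simp only [sum_inner, inner_smul_left, starRingEnd_apply, star_star]
  conv_rhs => rw [← h1]
  simp only [h5, h6, Finset.smul_sum, smul_smul]
  rw [Finset.sum_comm]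
  refine Finset.sum_congr rfl fun k _ => ?_
  rw [← Finset.sum_smul, ← h3]
  simp only [← hWx, Finset.sum_mul]
  rw [Finset.sum_comm]
  exact congrArg (· • σ k x) (Finset.sum_congr rfl fun j _ => Finset.sum_congr rfl fun l _ => by
    ring)

end Normalization

/-! ### Finitely many sections spanning every fiber -/

section Spanning

open Bundle Topology

/-- The dual form of spanning: failures are witnessed by nonzero linear forms on fibers, and these
can be counted by dimension. -/
theorem span_range_eq_top_iff {V : Type*} [AddCommGroup V] [Module ℂ V] {ι : Type*} (v : ι → V) :
    Submodule.span ℂ (Set.range v) = ⊤ ↔ ∀ f : V →ₗ[ℂ] ℂ, (∀ i, f (v i) = 0) → f = 0 := by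
  refine ⟨fun h f hf => LinearMap.ext_on_range h hf, fun h => ?_⟩
  by_contra hne
  obtain ⟨f, hf0, hf⟩ := Submodule.exists_le_ker_of_lt_top _ (lt_top_iff_ne_top.2 hne)
  exact hf0 (h f fun i => hf (Submodule.subset_span ⟨i, rfl⟩))

variable {d : ℕ} {M : Type*} [TopologicalSpace M] [ChartedSpace (EuclideanSpace ℝ (Fin d)) M]
  {F : Type*} [NormedAddCommGroup F] [NormedSpace ℂ F]
  {E : M → Type*} [TopologicalSpace (TotalSpace F E)] [∀ x, NormedAddCommGroup (E x)]
  [∀ x, InnerProductSpace ℂ (E x)] [FiberBundle F E] [VectorBundle ℝ F E]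

/-- The sections `σ_i` span the fibers over all points of `K`. -/
def SpansOn {ι : Type*} (σ : ι → Cₛ^∞⟮𝓡 d; F, E⟯) (K : Set M) : Prop :=
  ∀ x ∈ K, Submodule.span ℂ (Set.range fun i => σ i x) = ⊤

theorem SpansOn.exists_fin {ι : Type*} [Fintype ι] {σ : ι → Cₛ^∞⟮𝓡 d; F, E⟯} {K : Set M}
    (h : SpansOn σ K) : ∃ (n : ℕ) (τ : Fin n → Cₛ^∞⟮𝓡 d; F, E⟯), SpansOn τ K := by
  refine ⟨Fintype.card ι, σ ∘ (Fintype.equivFin ι).symm, fun x hx => ?_⟩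
  rw [← h x hx]
  exact congrArg _ ((Fintype.equivFin ι).symm.surjective.range_comp fun i => σ i x)

variable [FiniteDimensional ℂ F] [VectorBundle ℂ F E] [T2Space M]
  [IsManifold (𝓡 d) ∞ M] [ContMDiffVectorBundle ∞ F E (𝓡 d)]

/-- Cut off the local frame section by a bump function supported in the trivializing set. -/
theorem exists_section_eq_frame (x₀ : M) (w : F) :
    ∃ s : Cₛ^∞⟮𝓡 d; F, E⟯, ∀ᶠ x in 𝓝 x₀, s x = frame x₀ w x := by
  let e := trivializationAt F E x₀
  obtain ⟨ψ, -, hψ⟩ := (SmoothBumpFunction.nhds_basis_tsupport (I := 𝓡 d) x₀).mem_iff.1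
    (eventually_mem_baseSet (F := F) (E := E) x₀)
  have hf : ContMDiffOn (𝓡 d) ((𝓡 d).prod 𝓘(ℝ, F)) ∞
      (fun x => TotalSpace.mk' F x (frame (E := E) x₀ w x)) e.baseSet := by
    rw [e.contMDiffOn_section_baseSet_iff]
    refine (contMDiffOn_const (c := w)).congr fun x hx => ?_
    rw [e.apply_mk_symm hx]
  refine ⟨⟨_, ContMDiffOn.smul_section_of_tsupport ψ.contMDiff.contMDiffOn e.open_baseSet hψ hf⟩,
    ?_⟩
  filter_upwards [ψ.eventuallyEq_one] with x hx
  change ψ x • frame (F := F) (E := E) x₀ w x = _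
  rw [hx, Pi.one_apply, one_smul]

theorem exists_spansOn_nhds (x₀ : M) : ∃ (n : ℕ) (σ : Fin n → Cₛ^∞⟮𝓡 d; F, E⟯),
    ∃ U ∈ 𝓝 x₀, SpansOn σ U := by
  let b := Module.finBasis ℂ F
  choose σ hσ using fun i => exists_section_eq_frame (d := d) (E := E) x₀ (b i)
  refine ⟨_, σ, _, Filter.inter_mem (eventually_mem_baseSet (F := F) (E := E) x₀)
    (Filter.eventually_all.2 hσ), fun x hx => ?_⟩
  have hx' : ∀ i, σ i x = frame x₀ (b i) x := hx.2
  rw [span_range_eq_top_iff]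
  intro f hf
  let L := (trivializationAt F E x₀).continuousLinearEquivAt ℂ x hx.1
  have h0 : f.comp L.symm.toLinearEquiv.toLinearMap = 0 := b.ext fun i => by
    have := hf i
    rw [hx'] at this
    exact this
  ext v
  simpa using DFunLike.congr_fun h0 (L v)

theorem exists_spansOn_compact {K : Set M} (hK : IsCompact K) :
    ∃ (n : ℕ) (σ : Fin n → Cₛ^∞⟮𝓡 d; F, E⟯), SpansOn σ K := by
  choose n σ U hU hσ using fun x₀ => exists_spansOn_nhds (d := d) (F := F) (E := E) x₀
  obtain ⟨t, -, ht⟩ := hK.elim_nhds_subcover U fun x _ => hU x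
  refine SpansOn.exists_fin (ι := Σ x : t, Fin (n x)) (σ := fun i => σ i.1 i.2) fun x hx => ?_
  obtain ⟨y, hy, hxy⟩ := Set.mem_iUnion₂.1 (ht hx)
  refine eq_top_iff.2 ((hσ y x hxy).ge.trans (Submodule.span_mono ?_))
  rintro _ ⟨i, rfl⟩
  exact ⟨⟨⟨y, hy⟩, i⟩, rfl⟩

/-- Coordinates of a smooth section in a chart and a local trivialization. -/
theorem contDiffOn_section_coord (s : Cₛ^∞⟮𝓡 d; F, E⟯) (x₀ : M) :
    ContDiffOn ℝ ∞ (fun y => (trivializationAt F E x₀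
      ⟨(extChartAt (𝓡 d) x₀).symm y, s ((extChartAt (𝓡 d) x₀).symm y)⟩).2)
      ((extChartAt (𝓡 d) x₀).target ∩
        (extChartAt (𝓡 d) x₀).symm ⁻¹' (trivializationAt F E x₀).baseSet) := by
  rw [← contMDiffOn_iff_contDiffOn]
  have h1 : ContMDiffOn (𝓡 d) 𝓘(ℝ, F) ∞ (fun x => (trivializationAt F E x₀ ⟨x, s x⟩).2)
      (trivializationAt F E x₀).baseSet :=
    ((trivializationAt F E x₀).contMDiffOn_section_baseSet_iff).1 s.contMDiff.contMDiffOn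
  exact h1.comp ((contMDiffOn_extChartAt_symm x₀).mono Set.inter_subset_left) fun y hy => hy.2

/-- Near every point, the values `(ℓ(σ_i(x)))_i` of linear forms `ℓ` on the fibers form a set of
Hausdorff dimension at most the dimension of the total space. -/
theorem exists_nhds_dimH_le {ι : Type*} [Fintype ι] (σ : ι → Cₛ^∞⟮𝓡 d; F, E⟯) (x₀ : M) :
    ∃ U ∈ 𝓝 x₀, dimH {a : ι → ℂ | ∃ x ∈ U, ∃ f : E x →ₗ[ℂ] ℂ, ∀ i, a i = f (σ i x)} ≤
      Module.finrank ℝ (EuclideanSpace ℝ (Fin d) × (F →L[ℂ] ℂ)) := by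
  let e := trivializationAt F E x₀
  let φ := extChartAt (𝓡 d) x₀
  have hnhds : φ.target ∩ φ.symm ⁻¹' e.baseSet ∈ 𝓝 (φ x₀) := by
    refine Filter.inter_mem (extChartAt_target_mem_nhds x₀) ?_
    refine (continuousAt_extChartAt_symm x₀).preimage_mem_nhds ?_
    rw [extChartAt_to_inv]
    exact e.open_baseSet.mem_nhds (FiberBundle.mem_baseSet_trivializationAt' x₀)
  -- A ball is chosen because the bound on the dimension of a `C¹` image is applied on a convex set.
  obtain ⟨r, hr, hball⟩ := Metric.mem_nhds_iff.1 hnhds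
  let g : EuclideanSpace ℝ (Fin d) × (F →L[ℂ] ℂ) → ι → ℂ := fun p i =>
    p.2 (e ⟨φ.symm p.1, σ i (φ.symm p.1)⟩).2
  have hg : ContDiffOn ℝ 1 g (Metric.ball (φ x₀) r ×ˢ Set.univ) := by
    refine contDiffOn_pi.2 fun i => ?_
    have h1 : ContDiffOn ℝ 1 (fun p : EuclideanSpace ℝ (Fin d) × (F →L[ℂ] ℂ) =>
        (e ⟨φ.symm p.1, σ i (φ.symm p.1)⟩).2) (Metric.ball (φ x₀) r ×ˢ Set.univ) :=
      (((contDiffOn_section_coord (σ i) x₀).of_le (by exact_mod_cast le_top)).mono hball).comp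
        contDiff_fst.contDiffOn fun p hp => hp.1
    have h2 : ContDiff ℝ 1 (fun p : EuclideanSpace ℝ (Fin d) × (F →L[ℂ] ℂ) =>
        ContinuousLinearMap.restrictScalarsL ℂ F ℂ ℝ ℝ p.2) :=
      (ContinuousLinearMap.contDiff _).comp contDiff_snd
    exact h2.contDiffOn.clm_apply h1
  refine ⟨φ.source ∩ φ ⁻¹' Metric.ball (φ x₀) r, Filter.inter_mem (extChartAt_source_mem_nhds x₀)
    ((continuousAt_extChartAt x₀).preimage_mem_nhds (Metric.ball_mem_nhds _ hr)), ?_⟩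
  calc _ ≤ dimH (g '' (Metric.ball (φ x₀) r ×ˢ Set.univ)) := by
        refine dimH_mono ?_
        rintro a ⟨x, ⟨hxs, hxb⟩, f, hf⟩
        have hx : x ∈ e.baseSet := by
          have := (hball hxb).2
          rwa [Set.mem_preimage, φ.left_inv hxs] at this
        let L := e.continuousLinearEquivAt ℂ x hx
        refine ⟨(φ x, LinearMap.toContinuousLinearMap (f.comp L.symm.toLinearEquiv.toLinearMap)),
          ⟨hxb, Set.mem_univ _⟩, funext fun i => ?_⟩
        rw [hf]
        change f (L.symm (e ⟨φ.symm (φ x), σ i (φ.symm (φ x))⟩).2) = _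
        rw [φ.left_inv hxs]
        exact congrArg f (L.symm_apply_apply (σ i x))
    _ ≤ dimH (Metric.ball (φ x₀) r ×ˢ (Set.univ : Set (F →L[ℂ] ℂ))) :=
        hg.dimH_image_le ((convex_ball _ _).prod convex_univ) subset_rfl
    _ ≤ dimH (Set.univ : Set (EuclideanSpace ℝ (Fin d) × (F →L[ℂ] ℂ))) :=
        dimH_mono (Set.subset_univ _)
    _ = _ := Real.dimH_univ_eq_finrank _

/-- A spanning family of more sections than the dimension of the total space can be replaced
by a spanning family with one section less. -/
theorem SpansOn.exists_pred [SecondCountableTopology M] {m : ℕ}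
    {σ : Fin (m + 1) → Cₛ^∞⟮𝓡 d; F, E⟯} {K : Set M} (h : SpansOn σ K)
    (hm : Module.finrank ℝ (EuclideanSpace ℝ (Fin d) × (F →L[ℂ] ℂ)) < m) :
    ∃ τ : Fin m → Cₛ^∞⟮𝓡 d; F, E⟯, SpansOn τ K := by
  choose U hU hdim using exists_nhds_dimH_le fun i : Fin m => σ i.castSucc
  obtain ⟨S, hS, hcov⟩ := TopologicalSpace.countable_cover_nhds hU
  -- The set of all value vectors `(f(σ_i(x)))_i` has dimension below `m`, hence below `2m`, the
  -- real dimension of `ℂᵐ`; any `a` outside it can be used to project away the last section.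
  have hdense := dense_compl_of_dimH_lt_finrank (E := Fin m → ℂ) (s := ⋃ x₀ ∈ S,
    {a | ∃ x ∈ U x₀, ∃ f : E x →ₗ[ℂ] ℂ, ∀ i : Fin m, a i = f (σ i.castSucc x)}) (by
      rw [dimH_bUnion hS]
      refine (iSup₂_le fun x _ => hdim x).trans_lt ?_
      rw [Module.finrank_pi_fintype]
      simp only [Complex.finrank_real_complex, Finset.sum_const, Finset.card_univ, Fintype.card_fin,
        smul_eq_mul]
      exact_mod_cast hm.trans_le (by omega))
  obtain ⟨a, ha⟩ := hdense.nonempty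
  refine ⟨fun i => σ i.castSucc - a i • σ (Fin.last m), fun x hx => ?_⟩
  rw [span_range_eq_top_iff]
  intro f hf
  have hf' : ∀ i : Fin m, f (σ i.castSucc x) = a i * f (σ (Fin.last m) x) := fun i => by
    have h1 : f (σ i.castSucc x - a i • σ (Fin.last m) x) = 0 := hf i
    rwa [map_sub, map_smul, smul_eq_mul, sub_eq_zero] at h1
  by_cases h0 : f (σ (Fin.last m) x) = 0
  · refine (span_range_eq_top_iff _).1 (h x hx) f fun i => ?_
    refine Fin.lastCases h0 (fun i => ?_) i
    rw [hf', h0, mul_zero]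
  -- Rescaled to take the value 1 on the last section, `f` has value vector `a`, which was excluded.
  · refine absurd ?_ ha
    obtain ⟨x₀, hx₀, hxU⟩ := Set.mem_iUnion₂.1 (hcov ▸ Set.mem_univ x)
    refine Set.mem_iUnion₂.2 ⟨x₀, hx₀, x, hxU, (f (σ (Fin.last m) x))⁻¹ • f, fun i => ?_⟩
    rw [LinearMap.smul_apply, hf', smul_eq_mul]
    field_simp

/-- The point is that `N` does not depend on `K`, so that the families over all pieces of an
exhaustion have the same length. Short families are padded by zero, long ones shortened one section
at a time. -/
theorem SpansOn.exists_fin_of_finrank_lt [SecondCountableTopology M] {N : ℕ} {K : Set M}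
    (hN : Module.finrank ℝ (EuclideanSpace ℝ (Fin d) × (F →L[ℂ] ℂ)) < N)
    {n : ℕ} {σ : Fin n → Cₛ^∞⟮𝓡 d; F, E⟯} (h : SpansOn σ K) :
    ∃ τ : Fin N → Cₛ^∞⟮𝓡 d; F, E⟯, SpansOn τ K := by
  rcases le_total n N with hn | hn
  · refine ⟨fun i => if hi : i.1 < n then σ ⟨i, hi⟩ else 0, fun x hx => ?_⟩
    refine eq_top_iff.2 ((h x hx).ge.trans (Submodule.span_mono ?_))
    rintro _ ⟨i, rfl⟩
    exact ⟨⟨i, i.2.trans_le hn⟩, by simp⟩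
  · induction n, hn using Nat.le_induction with
    | base => exact ⟨σ, h⟩
    | succ m hm ih =>
      obtain ⟨τ, hτ⟩ := h.exists_pred (hN.trans_le hm)
      exact ih hτ

/-- There are finitely many smooth sections that span every fiber. -/
theorem exists_spansOn_univ [SecondCountableTopology M] :
    ∃ (n : ℕ) (σ : Fin n → Cₛ^∞⟮𝓡 d; F, E⟯), SpansOn σ Set.univ := by
  have : LocallyCompactSpace M := ChartedSpace.locallyCompactSpace (EuclideanSpace ℝ (Fin d)) M
  let S := (CompactExhaustion.choice M).shiftr
  have hS0 : S 0 = ∅ := rfl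
  let N := Module.finrank ℝ (EuclideanSpace ℝ (Fin d) × (F →L[ℂ] ℂ)) + 1
  have hloc : ∀ n, ∃ σ : Fin N → Cₛ^∞⟮𝓡 d; F, E⟯, SpansOn σ (S (n + 1)) := fun n =>
    let ⟨_, _, h⟩ := exists_spansOn_compact (F := F) (E := E) (S.isCompact (n + 1))
    h.exists_fin_of_finrank_lt (Nat.lt_succ_self _)
  choose σ hσ using hloc
  -- `χ n` is 1 on the `n`-th shell and lives on it and its two neighbors. For `n = 0` the truncated
  -- `n - 1` is harmless, as `S 0` is empty.
  have hbump : ∀ n, ∃ χ : C^∞⟮𝓡 d, M; 𝓘(ℝ), ℝ⟯, (∀ x, χ x ≠ 0 → x ∈ S (n + 2) \ S (n - 1)) ∧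
      ∀ x ∈ S (n + 1) \ S n, χ x = 1 := fun n => by
    have h1 : S (n - 1) ⊆ interior (S n) := by
      cases n with
      | zero => simp [hS0]
      | succ n => exact S.subset_interior_succ n
    obtain ⟨χ, h0, h1, -⟩ := exists_contMDiffMap_zero_one_of_isClosed (n := ⊤) (𝓡 d)
      (s := (interior (S (n + 2)) \ S (n - 1))ᶜ) (t := S (n + 1) \ interior (S n))
      (isOpen_interior.sdiff (S.isCompact _).isClosed).isClosed_compl
      ((S.isCompact _).isClosed.sdiff isOpen_interior) (by
        rw [Set.disjoint_compl_left_iff_subset]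
        exact fun x hx => ⟨S.subset_interior_succ _ hx.1, fun h => hx.2 (h1 h)⟩)
    refine ⟨χ, fun x hx => ?_, fun x hx => h1 ⟨hx.1, fun h => hx.2 (interior_subset h)⟩⟩
    by_contra hx'
    exact hx (h0 fun h => hx' ⟨interior_subset h.1, h.2⟩)
  choose χ hχ hχ1 using hbump
  have hlf : ∀ (c : Fin 3) (i : Fin N), LocallyFinite fun q : ℕ =>
      {x : M | χ (3 * q + c) x • σ (3 * q + c) i x ≠ 0} := fun c i x => by
    obtain ⟨j, hj⟩ := S.exists_mem_nhds x
    refine ⟨S j, hj, (Set.finite_Iic j).subset ?_⟩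
    rintro q ⟨y, hy, hyj⟩
    have hy' := (hχ (3 * q + c) y fun h => hy (by rw [h, zero_smul])).2
    by_contra hq
    exact hy' (S.subset (by simp at hq; omega) hyj)
  -- Indices congruent mod 3 have cutoffs with disjoint supports. So one sum per residue class
  -- suffices, and on the `n`-th shell the sum for `n % 3` reduces to `σ n i`.
  let τ (p : Fin 3 × Fin N) : Cₛ^∞⟮𝓡 d; F, E⟯ :=
    ⟨fun x => ∑ᶠ q : ℕ, χ (3 * q + p.1) x • σ (3 * q + p.1) p.2 x,
      ContMDiff.finsum_section_of_locallyFinite (hlf p.1 p.2) fun q =>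
        (χ _).contMDiff.smul_section (σ _ _).contMDiff⟩
  refine SpansOn.exists_fin (σ := τ) fun x _ => ?_
  have hx := (CompactExhaustion.choice M).mem_sdiff_shiftr_find x
  set n := (CompactExhaustion.choice M).find x
  have hτ : ∀ i, τ (⟨n % 3, Nat.mod_lt _ (by norm_num)⟩, i) x = σ n i x := fun i => by
    change ∑ᶠ q : ℕ, χ (3 * q + n % 3) x • σ (3 * q + n % 3) i x = _
    rw [finsum_eq_single _ (n / 3) fun q hq => ?_, Nat.div_add_mod, hχ1 n x hx, one_smul]
    have : χ (3 * q + n % 3) x = 0 := by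
      by_contra h
      obtain ⟨h1, h2⟩ := hχ _ x h
      rcases lt_or_gt_of_ne hq with hq | hq
      · exact hx.2 (S.subset (by omega) h1)
      · exact h2 (S.subset (by omega) hx.1)
    rw [this, zero_smul]
  refine eq_top_iff.2 ((hσ n x hx.1).ge.trans (Submodule.span_mono ?_))
  rintro _ ⟨i, rfl⟩
  exact ⟨_, hτ i⟩

end Spanning

end StarMorita

/-! ### The lemma on Hermitian vector bundles -/

theorem mainTheorem9 {d : ℕ}
    -- `M` is a smooth manifold
    {M : Type uM} [TopologicalSpace M] [ChartedSpace (EuclideanSpace ℝ (Fin d)) M]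
    [IsManifold (𝓡 d) ∞ M] [T2Space M] [SecondCountableTopology M]
    -- `E → M` is a smooth complex vector bundle with typical fiber `F ≠ 0`: the trivializations
    -- are `ℂ`-linear on fibers and the real bundle underlying `E` is smooth
    {F : Type uF} [NormedAddCommGroup F] [NormedSpace ℂ F] [FiniteDimensional ℂ F] [Nontrivial F]
    {E : M → Type uE} [TopologicalSpace (Bundle.TotalSpace F E)]
    [∀ x, NormedAddCommGroup (E x)] [∀ x, InnerProductSpace ℂ (E x)]
    [FiberBundle F E] [VectorBundle ℂ F E] [VectorBundle ℝ F E]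
    [ContMDiffVectorBundle ∞ F E (𝓡 d)]
    -- with a smooth Hermitian fiber metric
    [StarMorita.IsSmoothHermitianBundle (𝓡 d) F E] :
    StarMorita.IsMoritaEquivalenceBimodule.{v}
      (B := StarMorita.smoothEnd (𝓡 d) F E) (A := C^∞⟮𝓡 d, M; 𝓘(ℝ, ℂ), ℂ⟯)
      (E := Cₛ^∞⟮𝓡 d; F, E⟯)
      (StarMorita.sectionInner (𝓡 d)) (StarMorita.sectionTheta (𝓡 d)) ∧
    StarMorita.StronglyMoritaEquivalent.{max uM uE, v}
      (StarMorita.smoothEnd (𝓡 d) F E) C^∞⟮𝓡 d, M; 𝓘(ℝ, ℂ), ℂ⟯ ∧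
    -- `Γ^∞(E)` can be written isometrically as `P₀ C^∞(M)ⁿ` with a Hermitian projection `P₀`
    (∃ (n : ℕ) (P : Matrix (Fin n) (Fin n) C^∞⟮𝓡 d, M; 𝓘(ℝ, ℂ), ℂ⟯), IsStarProjection P ∧
      ∃ Φ : Cₛ^∞⟮𝓡 d; F, E⟯ ≃ₗ[(C^∞⟮𝓡 d, M; 𝓘(ℝ, ℂ), ℂ⟯)ᵐᵒᵖ] StarMorita.matrixRange P,
        ∀ s t, StarMorita.sectionInner (𝓡 d) s t =
          ∑ i, star ((Φ s : Fin n → C^∞⟮𝓡 d, M; 𝓘(ℝ, ℂ), ℂ⟯) i) *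
            (Φ t : Fin n → C^∞⟮𝓡 d, M; 𝓘(ℝ, ℂ), ℂ⟯) i) ∧
    -- and for every way of writing `Γ^∞(E) ≅ P₀ C^∞(M)ⁿ`, `P₀` is strongly full
    (∀ (n : ℕ) (P : Matrix (Fin n) (Fin n) C^∞⟮𝓡 d, M; 𝓘(ℝ, ℂ), ℂ⟯), IsStarProjection P →
      Nonempty (Cₛ^∞⟮𝓡 d; F, E⟯ ≃ₗ[(C^∞⟮𝓡 d, M; 𝓘(ℝ, ℂ), ℂ⟯)ᵐᵒᵖ] StarMorita.matrixRange P) →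
      StarMorita.IsStronglyFull P) := by
  obtain ⟨n, σ, hσ⟩ := StarMorita.exists_spansOn_univ (d := d) (F := F) (E := E)
  obtain ⟨s, hs⟩ := StarMorita.exists_isParsevalFrame fun x => hσ x (Set.mem_univ x)
  exact ⟨hs.isMoritaEquivalenceBimodule,
    ⟨_, _, _, _, _, _, _, hs.isMoritaEquivalenceBimodule⟩,
    ⟨n, hs.exists_equiv_matrixRange⟩,
    fun _ _ hP ⟨Ψ⟩ => hs.isStronglyFull_of_equiv hP Ψ⟩
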